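/- Let $f(x)=x-x^3$ and consider, for $h\in\mathbb R$, the equation $$\dot x=f(x)+h\cos(2\pi t).\qquad (1)$$ A solution of (1) is called stable if it is locally asymptotically stable and unstable if it is not Lyapunov stable. Let $h_c\in\mathbb R$, let $x_0$ be a 1-periodic solution of (1) for $h=h_c$ with $\int_0^1x_0\,dt=0$, and suppose that the zero-mean 1-periodic solution gains stability at $h_c$: for all $h<h_c$ close to $h_c$ the zero-mean 1-periodic solution of (1) is unstable, and for all $h>h_c$ close to $h_c$ it is stable. Then this bifurcation is a subcritical pitchfork, i.e. there are $\varepsilon,\delta>0$ such that: (a) for $|h-h_c|<\delta$ there is a zero-mean 1-periodic solution $x_s(h)$ of (1), depending continuously on $h$ in the uniform norm, with $x_s(h_c)=x_0$; (b) for $h_c-\delta<h<h_c$ there are exactly three 1-periodic solutions $x$ of (1) with $|x(t)-x_0(t)|<\varepsilon$ for all $t$, namely $x_-(h)<x_s(h)<x_+(h)$; here $x_s(h)$ is unstable, $x_\pm(h)$ are stable, and $x_-(h)(t)=-x_+(h)(t+\tfrac12)$; moreover $x_\pm(h)$ depend continuously on $h$ in the uniform norm and tend to $x_0$ as $h\uparrow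 h_c$; (c) for $h_c\le h<h_c+\delta$ the only 1-periodic solution $x$ of (1) with $|x(t)-x_0(t)|<\varepsilon$ for all $t$ is $x_s(h)$, and it is stable if $h>h_c$. Furthermore $\int_0^1f'(x_0(s))\,ds=0$. Put $v(t)=\exp\int_0^tf'(x_0(s))\,ds$, $v^*=1/v$, $\Phi_h(x)=\dot x-f(x)-h\cos(2\pi t)$, let $\langle\cdot,\cdot\rangle$ be the inner product of $L^2([0,1])$, and let $Ey=y-\frac{\langle v^*,y\rangle}{\langle v^*,v^*\rangle}v^*$. The Liapunov–Schmidt reduced function of $\Phi$ at $(x_0,h_c)$ exists near $(0,h_c)$; it is given by $g(\xi,h)=\langle v^*,\Phi_h(x_0+\xi v+W(\xi,h))\rangle$, where $W(\xi,h)$ is the unique $C^1$-small 1-periodic $C^1$ function with $\langle v,W\rangle=0$ and $E\,\Phi_h(x_0+\xi v+W)=0$. It is $C^\infty$ near $(0,h_c)$ (that is, $C^k$ near $(0,h_c)$ for every $k$), and $$g_{\xi\xi\xi}(0,h_c)=-\int_0^1f'''(x_0(s))\,v(s)^2\,ds>0 .$$ -/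

import Mathlib

open Set Filter Topology

namespace ForcedODE

/-- `x` solves `x' = f(x) + h cos(2πt)` on the set of times `s`
(one-sided derivatives at the end points of an interval). -/
def SolvesOn (f : ℝ → ℝ) (h : ℝ) (x : ℝ → ℝ) (s : Set ℝ) : Prop :=
  ∀ t ∈ s, HasDerivWithinAt x (f (x t) + h * Real.cos (2 * Real.pi * t)) s t

/-- A 1-periodic solution of `x' = f(x) + h cos(2πt)`. -/
def IsPeriodicSolution (f : ℝ → ℝ) (h : ℝ) (x : ℝ → ℝ) : Prop :=
  SolvesOn f h x univ ∧ Function.Periodic x 1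

/-- A 1-periodic solution with mean zero. -/
def IsZeroMeanSolution (f : ℝ → ℝ) (h : ℝ) (x : ℝ → ℝ) : Prop :=
  IsPeriodicSolution f h x ∧ ∫ t in (0 : ℝ)..1, x t = 0

/-- Lyapunov stability of the solution `x`. -/
def IsLyapunovStable (f : ℝ → ℝ) (h : ℝ) (x : ℝ → ℝ) : Prop :=
  ∀ ε > 0, ∃ δ > 0, ∀ (T : ℝ) (y : ℝ → ℝ), 0 < T → SolvesOn f h y (Icc 0 T) →
    |y 0 - x 0| < δ → ∀ t ∈ Icc 0 T, |y t - x t| < ε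

/-- Local asymptotic stability of the solution `x`. -/
def IsStable (f : ℝ → ℝ) (h : ℝ) (x : ℝ → ℝ) : Prop :=
  IsLyapunovStable f h x ∧
    ∃ δ > 0, ∀ y : ℝ → ℝ, SolvesOn f h y (Ici 0) → |y 0 - x 0| < δ →
      Tendsto (fun t => y t - x t) atTop (𝓝 0)

/-- Instability: failure of Lyapunov stability. -/
def IsUnstable (f : ℝ → ℝ) (h : ℝ) (x : ℝ → ℝ) : Prop :=
  ¬ IsLyapunovStable f h x

/-- As `h` increases through `hc`, the zero-mean 1-periodic solution turns from unstable to
stable. -/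
def IsStabilityGaining (f : ℝ → ℝ) (hc : ℝ) : Prop :=
  (∀ᶠ h in 𝓝[<] hc, ∀ x, IsZeroMeanSolution f h x → IsUnstable f h x) ∧
  (∀ᶠ h in 𝓝[>] hc, ∀ x, IsZeroMeanSolution f h x → IsStable f h x)

/-- The 1-periodic solutions for the amplitude `h` that are uniformly `ε`-close to `x₀`. -/
def nearbySolutions (f : ℝ → ℝ) (h : ℝ) (x₀ : ℝ → ℝ) (ε : ℝ) : Set (ℝ → ℝ) :=
  {x | IsPeriodicSolution f h x ∧ ∀ t, |x t - x₀ t| < ε}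

/-- A stability-gaining subcritical pitchfork at `(x₀, hc)` of the zero-mean solution: near `x₀`
there are, for `h < hc`, exactly three 1-periodic solutions, the central (zero-mean) one `xs h`
being unstable and the outer ones `xp h`, `xm h`, which are exchanged by the symmetry
`x(t) ↦ -x(t + 1/2)`, being stable; they depend continuously on `h` and merge into `x₀` at
`h = hc`; for `h ≥ hc` only the central solution is left, and it is stable for `h > hc`. -/
def IsSubcriticalPitchfork (f : ℝ → ℝ) (hc : ℝ) (x₀ : ℝ → ℝ) : Prop :=
  ∃ (xs xp xm : ℝ → ℝ → ℝ) (ε δ : ℝ), 0 < ε ∧ 0 < δ ∧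
    xs hc = x₀ ∧ xp hc = x₀ ∧ xm hc = x₀ ∧
    (∀ h ∈ Ioo (hc - δ) (hc + δ),
      IsZeroMeanSolution f h (xs h) ∧ TendstoUniformly xs (xs h) (𝓝 h)) ∧
    (∀ h ∈ Ioc (hc - δ) hc,
      TendstoUniformly xp (xp h) (𝓝[Iic hc] h) ∧
      TendstoUniformly xm (xm h) (𝓝[Iic hc] h)) ∧
    (∀ h ∈ Ioo (hc - δ) hc,
      nearbySolutions f h x₀ ε = {xm h, xs h, xp h} ∧
      (∀ t, xm h t < xs h t ∧ xs h t < xp h t) ∧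
      (∀ t, xm h t = -xp h (t + 1 / 2)) ∧
      IsUnstable f h (xs h) ∧ IsStable f h (xp h) ∧ IsStable f h (xm h)) ∧
    (∀ h ∈ Ico hc (hc + δ), nearbySolutions f h x₀ ε = {xs h}) ∧
    (∀ h ∈ Ioo hc (hc + δ), IsStable f h (xs h))

/-! ### Liapunov–Schmidt reduction -/

/-- The operator `Φ(x) = x' - f(x) - h cos(2πt)`. -/
noncomputable def Phi (f : ℝ → ℝ) (h : ℝ) (x : ℝ → ℝ) (t : ℝ) : ℝ :=
  deriv x t - f (x t) - h * Real.cos (2 * Real.pi * t)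

/-- The `L²([0,1])` inner product. -/
noncomputable def ip (a b : ℝ → ℝ) : ℝ := ∫ t in (0 : ℝ)..1, a t * b t

/-- The generator `v` of the kernel of `L = dΦ(x₀)`. -/
noncomputable def ker (f : ℝ → ℝ) (x₀ : ℝ → ℝ) (t : ℝ) : ℝ :=
  Real.exp (∫ s in (0 : ℝ)..t, deriv f (x₀ s))

/-- The generator `v*` of the orthogonal complement of the range of `L = dΦ(x₀)`. -/
noncomputable def coker (f : ℝ → ℝ) (x₀ : ℝ → ℝ) (t : ℝ) : ℝ :=
  Real.exp (-∫ s in (0 : ℝ)..t, deriv f (x₀ s))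

/-- The orthogonal projection `E` onto the range of `L`, i.e. onto the complement of `v*`. -/
noncomputable def projRange (f : ℝ → ℝ) (x₀ y : ℝ → ℝ) (t : ℝ) : ℝ :=
  y t - ip (coker f x₀) y / ip (coker f x₀) (coker f x₀) * coker f x₀ t

/-- `w` is a continuously differentiable 1-periodic function, orthogonal to `v`, of `C¹`-size
less than `ε`, which solves the range equation `E Φ(x₀ + ξ v + w) = 0` for the amplitude `h`. -/
def SolvesRangeEq (f : ℝ → ℝ) (x₀ : ℝ → ℝ) (ε ξ h : ℝ) (w : ℝ → ℝ) : Prop :=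
  ContDiff ℝ 1 w ∧ Function.Periodic w 1 ∧ ip (ker f x₀) w = 0 ∧
  (∀ t, |w t| < ε ∧ |deriv w t| < ε) ∧
  ∀ t, projRange f x₀ (Phi f h (fun s => x₀ s + ξ * ker f x₀ s + w s)) t = 0

/-- `g` is, near `(0, hc)`, the Liapunov–Schmidt reduced function based on `x₀`: for small
`(ξ, h - hc)` the range equation has exactly one small solution `W ξ h`, and
`g ξ h = ⟨v*, Φ(x₀ + ξ v + W ξ h)⟩`. This determines the germ of `g` at `(0, hc)`. -/
def IsReducedFunction (f : ℝ → ℝ) (hc : ℝ) (x₀ : ℝ → ℝ) (g : ℝ → ℝ → ℝ) : Prop :=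
  ∃ (W : ℝ → ℝ → ℝ → ℝ) (ε δ : ℝ), 0 < ε ∧ 0 < δ ∧
    ∀ ξ h, |ξ| < δ → |h - hc| < δ →
      SolvesRangeEq f x₀ ε ξ h (W ξ h) ∧
      (∀ w, SolvesRangeEq f x₀ ε ξ h w → w = W ξ h) ∧
      g ξ h = ip (coker f x₀) (Phi f h (fun s => x₀ s + ξ * ker f x₀ s + W ξ h s))

/-- The cubic nonlinearity. -/
def cubic (x : ℝ) : ℝ := x - x ^ 3

end ForcedODE

/-!
Write `f(x) = x - x³` and `λ(h) = ∫ f'(x_s(h))`, where `x_s(h)` is the zero-mean solution. The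
symmetry `x(t) ↦ -x(t + 1/2)` and the uniqueness of zero-mean solutions give
`x_s(t + 1/2) = -x_s(t)`.

Everything rests on one identity, `integral_deriv_cubic_eq`. Let `y > x_s` be a periodic solution
of the equation with an additional forcing `c e(t)`, where `e > 0` has period `1/2`, and put
`p = y - x_s`, `q(t) = p(t + 1/2)`. The quadratic terms in the equations for `p` and `q` are
opposite, and `S = 1/p + 1/q` satisfies `S'/S = -f'(x_s) + p q - c e (p² + q²) / (p q (p + q))`.
Integration over a period gives `λ = ∫ p q - c ∫ e (p² + q²) / (p q (p + q))`. Consequences: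

* for `c = 0`: no periodic solution other than `x_s` exists if `λ ≤ 0`, and at most one lies above
  `x_s` in any case, because `∫ p q` is strictly increasing in `p`;
* applied to nonperiodic solutions over half periods, the same function `S` shows that `x_s` is
  Lyapunov stable if `λ ≤ 0` (`IsZeroMeanSolution.isLyapunovStable`). As `x_s` is unstable for
  `λ > 0` (`IsPeriodicSolution.isUnstable`), gaining stability at `hc` means `λ > 0` to the left of
  `hc` and `λ ≤ 0` to the right, hence `λ(hc) = 0`;
* for small `ξ > 0` it determines the sign of `c` along the branch of solutions parametrized by a
  weighted mean `ξ`. This yields the outer solutions for `λ > 0`, and, as `p ~ ξ v`, it yields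
  `c ~ ξ³ ∫ v² / ∫ v*²` at `hc`. Since the reduced function is `g = c ∫ v*²`, its third derivative
  is `6 ∫ v²`, and `-6` is the third derivative of `f`.

The branch comes from the implicit function theorem in the Banach algebra of continuous periodic
functions (`exists_smooth_family`), applied to the bordered problem
`y' = f(y) + h cos(2πt) + c e`, `∫ w (y - x₀) = A ξ` with unknowns `(y, c)`. It is used with
`e = w = 1` for the pitchfork, where `λ(hc) = 0` is not yet known, and with `e = v*`, `w = v` for
the reduced function. For any positive `e` and `w`, solutions of the bordered problem are globally
unique and increasing in `ξ`: the difference `d` of two solutions satisfies `d' = m d + κ e`, so it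
can cross zero in one direction only, and a periodic `d` with a zero vanishes.

The outer solutions are asymptotically stable because the largest of three periodic solutions has
a negative Floquet exponent (`integral_deriv_cubic_neg_of_largest`), and the smallest is its mirror
image.
-/

namespace ForcedODE

open scoped ContDiff

/-! ### Scalar linear equations -/

lemma hasDerivAt_primitive {m : ℝ → ℝ} (hm : Continuous m) (t : ℝ) :
    HasDerivAt (fun t => ∫ s in (0 : ℝ)..t, m s) (m t) t :=
  (hm.integral_hasStrictDerivAt 0 t).hasDerivAt

lemma eq_mul_exp_of_linear_Icc {m d : ℝ → ℝ} {T : ℝ} (hm : Continuous m)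
    (hd : ∀ t ∈ Icc 0 T, HasDerivWithinAt d (m t * d t) (Icc 0 T) t) {t : ℝ} (ht : t ∈ Icc 0 T) :
    d t = d 0 * Real.exp (∫ s in (0 : ℝ)..t, m s) := by
  have hE : ∀ s, HasDerivAt (fun t => Real.exp (-∫ s in (0 : ℝ)..t, m s))
      (Real.exp (-∫ r in (0 : ℝ)..s, m r) * (-m s)) s := fun s =>
    (hasDerivAt_primitive hm s).neg.exp
  have hD : ∀ s ∈ Icc 0 T, HasDerivWithinAt
      (fun t => d t * Real.exp (-∫ s in (0 : ℝ)..t, m s)) 0 (Icc 0 T) s := by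
    intro s hs
    refine ((hd s hs).mul (hE s).hasDerivWithinAt).congr_deriv ?_
    ring
  have hconst := constant_of_has_deriv_right_zero
    (fun s hs => (hD s hs).continuousWithinAt)
    (fun s hs => ((hD s (Ico_subset_Icc_self hs)).mono_of_mem_nhdsWithin
      (Icc_mem_nhdsGE_of_mem hs))) t ht
  simp only [intervalIntegral.integral_same, neg_zero, Real.exp_zero, mul_one] at hconst
  rw [← hconst, mul_assoc, ← Real.exp_add]
  simp

lemma eq_mul_exp_of_linear {m d : ℝ → ℝ} (hm : Continuous m)
    (hd : ∀ t, HasDerivAt d (m t * d t) t) (t : ℝ) :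
    d t = d 0 * Real.exp (∫ s in (0 : ℝ)..t, m s) := by
  have hD : ∀ s, HasDerivAt (fun t => d t * Real.exp (-∫ s in (0 : ℝ)..t, m s)) 0 s := by
    intro s
    refine ((hd s).mul (hasDerivAt_primitive hm s).neg.exp).congr_deriv ?_
    ring
  have hconst := is_const_of_deriv_eq_zero (fun s => (hD s).differentiableAt)
    (fun s => (hD s).deriv) t 0
  simp only [intervalIntegral.integral_same, neg_zero, Real.exp_zero, mul_one] at hconst
  rw [← hconst, mul_assoc, ← Real.exp_add]
  simp

/-- A continuous function without zeros has constant sign. -/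
lemma pos_or_neg_of_ne_zero {d : ℝ → ℝ} (hd : Continuous d) (h0 : ∀ t, d t ≠ 0) :
    (∀ t, 0 < d t) ∨ ∀ t, d t < 0 := by
  by_contra! hcon
  obtain ⟨⟨s, hs⟩, ⟨t, ht⟩⟩ := hcon
  obtain ⟨r, hr⟩ := mem_range_of_exists_le_of_exists_ge hd ⟨s, hs⟩ ⟨t, ht⟩
  exact h0 r hr

lemma integral_mul_pos {w d : ℝ → ℝ} (hw : Continuous w) (hw0 : ∀ t, 0 < w t)
    (hd : Continuous d) (hd0 : ∀ t, 0 < d t) : 0 < ∫ t in (0 : ℝ)..1, w t * d t :=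
  intervalIntegral.intervalIntegral_pos_of_pos ((hw.mul hd).intervalIntegrable _ _)
    (fun t => mul_pos (hw0 t) (hd0 t)) one_pos

/-- The logarithmic derivative of a positive periodic function has mean zero. -/
lemma integral_eq_zero_of_periodic_linear {m d : ℝ → ℝ} (hm : Continuous m)
    (hd : ∀ t, HasDerivAt d (m t * d t) t) (hper : Function.Periodic d 1) (h0 : d 0 ≠ 0) :
    ∫ t in (0 : ℝ)..1, m t = 0 := by
  have h1 := eq_mul_exp_of_linear hm hd 1
  have h2 : d 1 = d 0 := by simpa using hper 0
  rw [h2] at h1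
  have h3 : Real.exp (∫ t in (0 : ℝ)..1, m t) = 1 := by
    have := mul_left_cancel₀ h0 ((mul_one (d 0)).trans h1)
    exact this.symm
  exact Real.exp_eq_one_iff _ |>.1 h3

/-- At a zero, a solution of `d' = m d + κ e` with `e > 0` crosses in the direction given by the
sign of `κ`, so a periodic solution that has a zero vanishes identically. -/
lemma eq_zero_of_periodic_of_zero {m e d : ℝ → ℝ} {κ : ℝ} (hm : Continuous m)
    (he : ∀ t, 0 < e t) (hd : ∀ t, HasDerivAt d (m t * d t + κ * e t) t)
    (hper : Function.Periodic d 1) {t₀ : ℝ} (h0 : d t₀ = 0) : κ = 0 ∧ ∀ t, d t = 0 := by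
  have hD : ∀ s, HasDerivAt (fun t => d t * Real.exp (-∫ s in (0 : ℝ)..t, m s))
      (κ * (e s * Real.exp (-∫ r in (0 : ℝ)..s, m r))) s := by
    intro s
    refine ((hd s).mul (hasDerivAt_primitive hm s).neg.exp).congr_deriv ?_
    simp only [Pi.neg_apply]
    ring
  have hpos : ∀ s, 0 < e s * Real.exp (-∫ r in (0 : ℝ)..s, m r) := fun s =>
    mul_pos (he s) (Real.exp_pos _)
  have h1 : d (t₀ + 1) = 0 := (hper t₀).trans h0
  have hlt : t₀ < t₀ + 1 := by linarith
  have hκ : κ = 0 := by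
    rcases lt_trichotomy κ 0 with h | h | h
    · have := strictAnti_of_deriv_neg
        (fun s => by rw [(hD s).deriv]; exact mul_neg_of_neg_of_pos h (hpos s)) hlt
      simp [h0, h1] at this
    · exact h
    · have := strictMono_of_deriv_pos
        (fun s => by rw [(hD s).deriv]; exact mul_pos h (hpos s)) hlt
      simp [h0, h1] at this
  refine ⟨hκ, fun t => ?_⟩
  subst hκ
  have hl := eq_mul_exp_of_linear hm (d := d) (fun s => by simpa using hd s)
  have hd0 : d 0 = 0 := by
    have := hl t₀
    rw [h0] at this
    exact (mul_eq_zero.1 this.symm).resolve_right (Real.exp_ne_zero _)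
  rw [hl t, hd0, zero_mul]

/-- The homogeneous bordered problem `d' = m d + κ e`, `∫ w d = 0` has only the zero solution: a
function with vanishing weighted mean has a zero. -/
lemma eq_zero_of_periodic_of_integral_eq_zero {m e d w : ℝ → ℝ} {κ : ℝ} (hm : Continuous m)
    (he : ∀ t, 0 < e t) (hd : ∀ t, HasDerivAt d (m t * d t + κ * e t) t)
    (hper : Function.Periodic d 1) (hw : Continuous w) (hw0 : ∀ t, 0 < w t)
    (hint : ∫ t in (0 : ℝ)..1, w t * d t = 0) : κ = 0 ∧ ∀ t, d t = 0 := by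
  have hdc : Continuous d := continuous_iff_continuousAt.2 fun t => (hd t).continuousAt
  by_cases hz : ∃ t, d t = 0
  · obtain ⟨t, ht⟩ := hz
    exact eq_zero_of_periodic_of_zero hm he hd hper ht
  · push Not at hz
    exfalso
    rcases pos_or_neg_of_ne_zero hdc hz with h | h
    · exact (integral_mul_pos hw hw0 hdc h).ne' hint
    · have := integral_mul_pos hw hw0 hdc.neg (fun t => neg_pos.2 (h t))
      simp [hint] at this

lemma pos_of_periodic_of_integral_pos {m e d w : ℝ → ℝ} {κ : ℝ} (hm : Continuous m)
    (he : ∀ t, 0 < e t) (hd : ∀ t, HasDerivAt d (m t * d t + κ * e t) t)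
    (hper : Function.Periodic d 1) (hw : Continuous w) (hw0 : ∀ t, 0 < w t)
    (hint : 0 < ∫ t in (0 : ℝ)..1, w t * d t) : ∀ t, 0 < d t := by
  have hdc : Continuous d := continuous_iff_continuousAt.2 fun t => (hd t).continuousAt
  have hz : ∀ t, d t ≠ 0 := fun t ht => by
    have := (eq_zero_of_periodic_of_zero hm he hd hper ht).2
    simp [this] at hint
  rcases pos_or_neg_of_ne_zero hdc hz with h | h
  · exact h
  · have := integral_mul_pos hw hw0 hdc.neg (fun t => neg_pos.2 (h t))
    simp only [Pi.neg_apply, mul_neg, intervalIntegral.integral_neg] at this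
    linarith

/-! ### Inhomogeneous linear equations with periodic coefficients -/

/-- The solution of `z' = a z + b` with `z 0 = 0`. -/
noncomputable def duhamel (a b : ℝ → ℝ) (t : ℝ) : ℝ :=
  Real.exp (∫ s in (0 : ℝ)..t, a s) *
    ∫ s in (0 : ℝ)..t, b s * Real.exp (-∫ r in (0 : ℝ)..s, a r)

lemma continuous_primitive {a : ℝ → ℝ} (ha : Continuous a) :
    Continuous fun t => ∫ s in (0 : ℝ)..t, a s :=
  continuous_iff_continuousAt.2 fun t => (hasDerivAt_primitive ha t).continuousAt

lemma hasDerivAt_duhamel {a b : ℝ → ℝ} (ha : Continuous a) (hb : Continuous b) (t : ℝ) :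
    HasDerivAt (duhamel a b) (a t * duhamel a b t + b t) t := by
  have hc : Continuous fun s => b s * Real.exp (-∫ r in (0 : ℝ)..s, a r) :=
    hb.mul (Real.continuous_exp.comp (continuous_primitive ha).neg)
  refine ((hasDerivAt_primitive ha t).exp.mul (hasDerivAt_primitive hc t)).congr_deriv ?_
  have : Real.exp (∫ s in (0 : ℝ)..t, a s) * Real.exp (-∫ s in (0 : ℝ)..t, a s) = 1 := by
    rw [← Real.exp_add]; simp
  unfold duhamel
  linear_combination b t * this

@[simp] lemma duhamel_zero (a b : ℝ → ℝ) : duhamel a b 0 = 0 := by simp [duhamel]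

lemma periodic_of_eq_at_one {a b z : ℝ → ℝ} (ha : Continuous a) (hap : Function.Periodic a 1)
    (hbp : Function.Periodic b 1) (hz : ∀ t, HasDerivAt z (a t * z t + b t) t)
    (h1 : z 1 = z 0) : Function.Periodic z 1 := by
  have hd : ∀ t, HasDerivAt (fun t => z (t + 1) - z t) (a t * (z (t + 1) - z t)) t := by
    intro t
    refine (((hz (t + 1)).comp_add_const t 1).sub (hz t)).congr_deriv ?_
    rw [hap t, hbp t]
    ring
  intro t
  have := eq_mul_exp_of_linear ha hd t
  simp only [zero_add, h1, sub_self, zero_mul] at this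
  linarith

/-- The bordered linear problem `z' = a z + κ e + b`, `∫ w z = s`, is solvable in `(z, κ)` by a
periodic `z`. Its solutions are `z = k v + κ z_e + z_b`, so it amounts to two linear equations for
`(k, κ)`; the homogeneous equations have only the zero solution. -/
lemma exists_periodic_bordered {a e w b : ℝ → ℝ} (ha : Continuous a) (hap : Function.Periodic a 1)
    (he : Continuous e) (hep : Function.Periodic e 1) (he0 : ∀ t, 0 < e t)
    (hw : Continuous w) (hw0 : ∀ t, 0 < w t)
    (hb : Continuous b) (hbp : Function.Periodic b 1) (s : ℝ) :
    ∃ (z : ℝ → ℝ) (κ : ℝ), (∀ t, HasDerivAt z (a t * z t + (κ * e t + b t)) t) ∧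
      Function.Periodic z 1 ∧ ∫ t in (0 : ℝ)..1, w t * z t = s := by
  set v : ℝ → ℝ := fun t => Real.exp (∫ s in (0 : ℝ)..t, a s) with hv
  have hvd : ∀ t, HasDerivAt v (a t * v t) t := fun t => by
    simpa [hv, mul_comm] using (hasDerivAt_primitive ha t).exp
  have hcont : ∀ {f f' : ℝ → ℝ}, (∀ t, HasDerivAt f (f' t) t) → Continuous f := fun h =>
    continuous_iff_continuousAt.2 fun t => (h t).continuousAt
  have hvc : Continuous v := hcont hvd
  have hec : Continuous (duhamel a e) := hcont (hasDerivAt_duhamel ha he)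
  have hbc : Continuous (duhamel a b) := hcont (hasDerivAt_duhamel ha hb)
  have hv0 : v 0 = 1 := by simp [hv]
  let M : ℝ × ℝ →ₗ[ℝ] ℝ × ℝ :=
    { toFun := fun p => (p.1 * (v 1 - 1) + p.2 * duhamel a e 1,
        p.1 * (∫ t in (0 : ℝ)..1, w t * v t) + p.2 * ∫ t in (0 : ℝ)..1, w t * duhamel a e t)
      map_add' := fun p q => by ext <;> simp <;> ring
      map_smul' := fun c p => by ext <;> simp <;> ring }
  have hlin : ∀ k κ β : ℝ, ∫ t in (0 : ℝ)..1, w t * (k * v t + κ * duhamel a e t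
      + β * duhamel a b t) = k * (∫ t in (0 : ℝ)..1, w t * v t)
      + κ * (∫ t in (0 : ℝ)..1, w t * duhamel a e t)
      + β * ∫ t in (0 : ℝ)..1, w t * duhamel a b t := by
    intro k κ β
    rw [← intervalIntegral.integral_const_mul, ← intervalIntegral.integral_const_mul,
      ← intervalIntegral.integral_const_mul, ← intervalIntegral.integral_add,
      ← intervalIntegral.integral_add]
    · congr 1; ext t; ring
    all_goals exact Continuous.intervalIntegrable (by fun_prop) _ _
  have hder : ∀ k κ β : ℝ, ∀ t, HasDerivAt (fun t => k * v t + κ * duhamel a e t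
      + β * duhamel a b t) (a t * (k * v t + κ * duhamel a e t + β * duhamel a b t)
        + (κ * e t + β * b t)) t := by
    intro k κ β t
    refine ((((hvd t).const_mul k).add ((hasDerivAt_duhamel ha he t).const_mul κ)).add
      ((hasDerivAt_duhamel ha hb t).const_mul β)).congr_deriv ?_
    ring
  have hper : ∀ k κ β : ℝ, k * (v 1 - 1) + κ * duhamel a e 1 + β * duhamel a b 1 = 0 →
      Function.Periodic (fun t => k * v t + κ * duhamel a e t + β * duhamel a b t) 1 := by
    intro k κ β h
    refine periodic_of_eq_at_one ha hap (b := fun t => κ * e t + β * b t) ?_ (hder k κ β) ?_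
    · intro t; simp [hep t, hbp t]
    · simp only [duhamel_zero, hv0]
      linarith
  have hinj : Function.Injective M := by
    rw [← LinearMap.ker_eq_bot, LinearMap.ker_eq_bot']
    rintro ⟨k, κ⟩ h
    simp only [M, LinearMap.coe_mk, AddHom.coe_mk, Prod.mk_eq_zero] at h
    have hz := eq_zero_of_periodic_of_integral_eq_zero ha he0
      (d := fun t => k * v t + κ * duhamel a e t + 0 * duhamel a b t) (κ := κ)
      (fun t => by simpa using hder k κ 0 t) (hper k κ 0 (by linarith [h.1])) hw hw0
      (by rw [hlin]; linarith [h.2])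
    have := hz.2 0
    simp only [hv0, duhamel_zero] at this
    ext <;> simp <;> linarith [hz.1]
  obtain ⟨⟨k, κ⟩, hkκ⟩ := LinearMap.injective_iff_surjective.1 hinj
    (-duhamel a b 1, s - ∫ t in (0 : ℝ)..1, w t * duhamel a b t)
  simp only [M, LinearMap.coe_mk, AddHom.coe_mk, Prod.mk.injEq] at hkκ
  refine ⟨_, κ, fun t => by simpa using hder k κ 1 t, hper k κ 1 (by linarith [hkκ.1]), ?_⟩
  rw [hlin]
  linarith [hkκ.2]

/-! ### Continuous functions on the circle -/

/-- The Banach algebra of continuous 1-periodic functions. -/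
abbrev Circ := C(UnitAddCircle, ℝ)

/-- A continuous 1-periodic function on the line, as a function on the circle. -/
def toCirc (z : ℝ → ℝ) (hz : Continuous z) (hp : Function.Periodic z 1) : Circ :=
  ⟨hp.lift, continuous_quot_lift _ hz⟩

@[simp] lemma toCirc_apply (z : ℝ → ℝ) (hz : Continuous z) (hp : Function.Periodic z 1) (t : ℝ) :
    toCirc z hz hp (t : UnitAddCircle) = z t := hp.lift_coe t

lemma Circ.ext {y z : Circ} (h : ∀ t : ℝ, y (t : UnitAddCircle) = z (t : UnitAddCircle)) :
    y = z := by
  ext x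
  obtain ⟨t, rfl⟩ := QuotientAddGroup.mk_surjective x
  exact h t

lemma Circ.continuous_coe (y : Circ) : Continuous fun t : ℝ => y (t : UnitAddCircle) :=
  y.continuous.comp (AddCircle.continuous_mk' 1)

lemma Circ.periodic_coe (y : Circ) : Function.Periodic (fun t : ℝ => y (t : UnitAddCircle)) 1 := by
  intro t
  simp

/-- The mean value of a continuous periodic function. -/
noncomputable def meanL : Circ →L[ℝ] ℝ :=
  LinearMap.mkContinuous
    { toFun := fun y => ∫ t in (0 : ℝ)..1, y (t : UnitAddCircle)
      map_add' := fun y z => intervalIntegral.integral_add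
        (y.continuous_coe.intervalIntegrable _ _) (z.continuous_coe.intervalIntegrable _ _)
      map_smul' := fun c y => intervalIntegral.integral_const_mul c _ } 1
    (fun y => by
      have := intervalIntegral.norm_integral_le_of_norm_le_const (a := (0 : ℝ)) (b := 1)
        (f := fun t : ℝ => y (t : UnitAddCircle)) (C := ‖y‖) (fun t _ => y.norm_coe_le_norm _)
      simpa using this)

lemma meanL_apply (y : Circ) : meanL y = ∫ t in (0 : ℝ)..1, y (t : UnitAddCircle) := rfl

/-- The periodic primitive `t ↦ ∫₀ᵗ y - t ∫₀¹ y` of `y` minus its mean. -/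
noncomputable def primFun (y : Circ) (t : ℝ) : ℝ :=
  (∫ s in (0 : ℝ)..t, y (s : UnitAddCircle)) - t * meanL y

lemma hasDerivAt_primFun (y : Circ) (t : ℝ) :
    HasDerivAt (primFun y) (y (t : UnitAddCircle) - meanL y) t := by
  refine ((hasDerivAt_primitive y.continuous_coe t).sub
    ((hasDerivAt_id t).mul_const (meanL y))).congr_deriv ?_
  ring

lemma continuous_primFun (y : Circ) : Continuous (primFun y) :=
  continuous_iff_continuousAt.2 fun t => (hasDerivAt_primFun y t).continuousAt

lemma periodic_primFun (y : Circ) : Function.Periodic (primFun y) 1 := by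
  intro t
  have h := y.periodic_coe.intervalIntegral_add_eq t 0
  have h2 := intervalIntegral.integral_add_adjacent_intervals
    (y.continuous_coe.intervalIntegrable (μ := MeasureTheory.volume) 0 t)
    (y.continuous_coe.intervalIntegrable t (t + 1))
  rw [zero_add] at h
  simp only [primFun, meanL_apply]
  rw [← h2, h]
  ring

/-- The continuous linear operator taking the periodic primitive of `y` minus its mean. -/
noncomputable def primL : Circ →L[ℝ] Circ :=
  LinearMap.mkContinuous
    { toFun := fun y => toCirc (primFun y) (continuous_primFun y) (periodic_primFun y)
      map_add' := fun y z => Circ.ext fun t => by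
        simp only [toCirc_apply, ContinuousMap.add_apply, primFun, map_add]
        rw [intervalIntegral.integral_add
          (y.continuous_coe.intervalIntegrable _ _) (z.continuous_coe.intervalIntegrable _ _)]
        ring
      map_smul' := fun c y => Circ.ext fun t => by
        simp only [toCirc_apply, ContinuousMap.smul_apply, primFun, map_smul, smul_eq_mul,
          RingHom.id_apply, intervalIntegral.integral_const_mul]
        ring } 2
    (fun y => by
      refine (ContinuousMap.norm_le _ (by positivity)).2 fun x => ?_
      obtain ⟨t, ⟨ht0, ht1⟩, rfl⟩ := AddCircle.eq_coe_Ico x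
      have h1 := intervalIntegral.norm_integral_le_of_norm_le_const (a := (0 : ℝ)) (b := t)
        (f := fun t : ℝ => y (t : UnitAddCircle)) (C := ‖y‖) (fun t _ => y.norm_coe_le_norm _)
      have h2 := intervalIntegral.norm_integral_le_of_norm_le_const (a := (0 : ℝ)) (b := 1)
        (f := fun t : ℝ => y (t : UnitAddCircle)) (C := ‖y‖) (fun t _ => y.norm_coe_le_norm _)
      rw [sub_zero, abs_of_nonneg ht0] at h1
      rw [sub_zero, abs_one, mul_one, ← meanL_apply] at h2
      have hy := norm_nonneg y
      have h3 : ‖t * meanL y‖ ≤ 1 * ‖y‖ := by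
        rw [norm_mul]
        refine mul_le_mul ?_ h2 (norm_nonneg _) zero_le_one
        rw [Real.norm_of_nonneg ht0]; exact ht1.le
      calc ‖primFun y t‖ ≤ ‖∫ s in (0 : ℝ)..t, y (s : UnitAddCircle)‖ + ‖t * meanL y‖ :=
            norm_sub_le _ _
        _ ≤ ‖y‖ * 1 + 1 * ‖y‖ := add_le_add (h1.trans (by gcongr)) h3
        _ = 2 * ‖y‖ := by ring)

@[simp] lemma primL_apply (y : Circ) (t : ℝ) : primL y (t : UnitAddCircle) = primFun y t :=
  toCirc_apply _ (continuous_primFun y) (periodic_primFun y) t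

/-- The operator `(y, F) ↦ y - y(0) - ∫₀ᵗ F + (1 + t) ∫₀¹ F`, whose vanishing encodes `y' = F`
for periodic `y`: at `t = 0` it says that `F` has mean zero. -/
noncomputable def odeL : Circ × Circ →L[ℝ] Circ :=
  ContinuousLinearMap.fst ℝ Circ Circ
    - ((ContinuousMap.evalCLM ℝ (0 : UnitAddCircle)).comp
        (ContinuousLinearMap.fst ℝ Circ Circ)).smulRight (1 : Circ)
    - primL.comp (ContinuousLinearMap.snd ℝ Circ Circ)
    + (meanL.comp (ContinuousLinearMap.snd ℝ Circ Circ)).smulRight (1 : Circ)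

lemma odeL_apply (y F : Circ) (t : ℝ) : odeL (y, F) (t : UnitAddCircle) =
    y (t : UnitAddCircle) - y 0 - primFun F t + meanL F := by
  simp [odeL]

lemma odeL_eq_zero_iff (y F : Circ) : odeL (y, F) = 0 ↔
    ∀ t : ℝ, HasDerivAt (fun t : ℝ => y (t : UnitAddCircle)) (F (t : UnitAddCircle)) t := by
  have h00 : ((0 : ℝ) : UnitAddCircle) = 0 := rfl
  constructor
  · intro h
    have h' : ∀ t : ℝ, y (t : UnitAddCircle) - y 0 - primFun F t + meanL F = 0 := fun t => by
      rw [← odeL_apply, h]; rfl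
    have hm : meanL F = 0 := by
      have := h' 0
      rw [h00] at this
      simpa [primFun] using this
    have hy : (fun t : ℝ => y (t : UnitAddCircle)) = fun t => y 0 + primFun F t := by
      ext t; linarith [h' t]
    intro t
    rw [hy]
    simpa [hm] using (hasDerivAt_primFun F t).const_add (y 0)
  · intro h
    have hint : ∀ t : ℝ, ∫ s in (0 : ℝ)..t, F (s : UnitAddCircle) = y (t : UnitAddCircle) - y 0 :=
      fun t => intervalIntegral.integral_eq_sub_of_hasDerivAt (fun s _ => h s)
        (F.continuous_coe.intervalIntegrable _ _)
    have hm : meanL F = 0 := by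
      rw [meanL_apply, hint, AddCircle.coe_period, sub_self]
    refine Circ.ext fun t => ?_
    rw [odeL_apply, primFun, hint, hm]
    simp

/-- The forcing profile `cos(2πt)`. -/
noncomputable def cosC : Circ :=
  toCirc (fun t => Real.cos (2 * Real.pi * t)) (by fun_prop) (fun t => by
    beta_reduce
    rw [mul_add, mul_one, Real.cos_add_two_pi])

@[simp] lemma cosC_apply (t : ℝ) : cosC (t : UnitAddCircle) = Real.cos (2 * Real.pi * t) :=
  toCirc_apply _ _ _ t

/-! ### Smooth families of solutions of the bordered problem -/

/-- The bordered operator: for parameters `p = (ξ, h)` and unknowns `q = (y, c)` it vanishes iff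
`y' = y - y³ + h cos(2πt) + c e` and `∫ w (y - x₀) = A ξ`. -/
noncomputable def bordered (x₀ e w : Circ) (A : ℝ) (u : (ℝ × ℝ) × (Circ × ℝ)) : Circ × ℝ :=
  (odeL (u.2.1, u.2.1 - u.2.1 ^ 3 + u.1.2 • cosC + u.2.2 • e),
    meanL (w * (u.2.1 - x₀)) - A * u.1.1)

lemma contDiff_bordered (x₀ e w : Circ) (A : ℝ) : ContDiff ℝ ∞ (bordered x₀ e w A) := by
  unfold bordered
  have h1 : ContDiff ℝ ∞ fun u : (ℝ × ℝ) × (Circ × ℝ) => u.2.1 := by fun_prop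
  have h2 : ContDiff ℝ ∞ fun u : (ℝ × ℝ) × (Circ × ℝ) => u.2.1 ^ 3 := h1.pow 3
  have h3 : ContDiff ℝ ∞ fun u : (ℝ × ℝ) × (Circ × ℝ) => w * (u.2.1 - x₀) :=
    contDiff_const.mul (h1.sub contDiff_const)
  refine ContDiff.prodMk (odeL.contDiff.comp (h1.prodMk ?_)) ?_
  · exact ((h1.sub h2).add (by fun_prop)).add (by fun_prop)
  · exact (meanL.contDiff.comp h3).sub (by fun_prop)

/-- The linearization of the bordered operator in the unknowns. -/
noncomputable def borderedL (x₀ e w : Circ) : Circ × ℝ →L[ℝ] Circ × ℝ :=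
  (odeL.comp ((ContinuousLinearMap.fst ℝ Circ ℝ).prod
    ((ContinuousLinearMap.mul ℝ Circ (1 - 3 * x₀ ^ 2)).comp (ContinuousLinearMap.fst ℝ Circ ℝ)
      + (ContinuousLinearMap.snd ℝ Circ ℝ).smulRight e))).prod
  (meanL.comp ((ContinuousLinearMap.mul ℝ Circ w).comp (ContinuousLinearMap.fst ℝ Circ ℝ)))

lemma borderedL_apply (x₀ e w η : Circ) (κ : ℝ) : borderedL x₀ e w (η, κ) =
    (odeL (η, (1 - 3 * x₀ ^ 2) * η + κ • e), meanL (w * η)) := by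
  simp [borderedL, -map_sub, sub_mul]

lemma hasFDerivAt_bordered (x₀ e w : Circ) (A : ℝ) (p : ℝ × ℝ) :
    HasFDerivAt (fun q : Circ × ℝ => bordered x₀ e w A (p, q)) (borderedL x₀ e w) (x₀, 0) := by
  have h1 : HasFDerivAt (fun q : Circ × ℝ => q.1) (ContinuousLinearMap.fst ℝ Circ ℝ) (x₀, 0) :=
    hasFDerivAt_fst
  have h2 : HasFDerivAt (fun q : Circ × ℝ => q.2 • e)
      ((ContinuousLinearMap.snd ℝ Circ ℝ).smulRight e) (x₀, 0) :=
    ((ContinuousLinearMap.snd ℝ Circ ℝ).smulRight e).hasFDerivAt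
  have h3 := ((h1.sub (h1.pow 3)).add (hasFDerivAt_const (p.2 • cosC) (x₀, (0 : ℝ)))).add h2
  have h4 : HasFDerivAt (fun q : Circ × ℝ => w * (q.1 - x₀))
      ((ContinuousLinearMap.mul ℝ Circ w).comp (ContinuousLinearMap.fst ℝ Circ ℝ)) (x₀, 0) :=
    (ContinuousLinearMap.mul ℝ Circ w).hasFDerivAt.comp (x₀, (0 : ℝ)) (h1.sub_const x₀)
  have h5 := (odeL.hasFDerivAt.comp (x₀, (0 : ℝ)) (h1.prodMk h3)).prodMk
    ((meanL.hasFDerivAt.comp (x₀, (0 : ℝ)) h4).sub_const (A * p.1))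
  refine h5.congr_fderiv ?_
  ext q <;> simp [borderedL]


lemma bordered_eq_zero_iff (x₀ e w y : Circ) (A ξ h c : ℝ) :
    bordered x₀ e w A ((ξ, h), (y, c)) = 0 ↔
      (∀ t : ℝ, HasDerivAt (fun t : ℝ => y (t : UnitAddCircle))
        (cubic (y (t : UnitAddCircle)) + h * Real.cos (2 * Real.pi * t)
          + c * e (t : UnitAddCircle)) t) ∧
      ∫ t in (0 : ℝ)..1, w (t : UnitAddCircle) * (y (t : UnitAddCircle) - x₀ (t : UnitAddCircle))
        = A * ξ := by
  simp only [bordered, Prod.mk_eq_zero, odeL_eq_zero_iff, sub_eq_zero]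
  simp [meanL_apply, cubic]

/-- The linearized bordered problem is uniquely solvable. -/
lemma bijective_borderedL (x₀ : Circ) {e w : Circ} (he : ∀ x, 0 < e x) (hw : ∀ x, 0 < w x) :
    Function.Bijective (borderedL x₀ e w) := by
  set a : Circ := 1 - 3 * x₀ ^ 2 with ha
  constructor
  · refine (injective_iff_map_eq_zero _).2 ?_
    rintro ⟨η, κ⟩ h
    rw [borderedL_apply, Prod.mk_eq_zero, odeL_eq_zero_iff] at h
    obtain ⟨hκ, hη⟩ := eq_zero_of_periodic_of_integral_eq_zero (κ := κ) a.continuous_coe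
      (e := fun t => e (t : UnitAddCircle)) (w := fun t => w (t : UnitAddCircle))
      (fun t => he t) (fun t => h.1 t) η.periodic_coe w.continuous_coe
      (fun t => hw t) (by simpa [meanL_apply] using h.2)
    exact Prod.ext (Circ.ext fun t => by simpa using hη t) hκ
  · rintro ⟨r, s⟩
    -- With `η = z + r` the equation becomes `z' = a z + κ e + (a r - r(0))`.
    set b : Circ := a * r - r 0 • (1 : Circ) with hb
    obtain ⟨z, κ, hz, hzp, hzi⟩ := exists_periodic_bordered a.continuous_coe a.periodic_coe
      e.continuous_coe e.periodic_coe (fun t => he t) w.continuous_coe (fun t => hw t)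
      b.continuous_coe b.periodic_coe (s - meanL (w * r))
    have hzc : Continuous z := continuous_iff_continuousAt.2 fun t => (hz t).continuousAt
    set Z : Circ := toCirc z hzc hzp with hZ
    have hZ0 : odeL (Z, a * Z + κ • e + b) = 0 := by
      refine (odeL_eq_zero_iff _ _).2 fun t => ?_
      simpa [hZ, add_assoc] using hz t
    have hr : odeL (r, r 0 • (1 : Circ)) = r := by
      refine Circ.ext fun t => ?_
      rw [odeL_apply]
      simp [primFun, meanL_apply]
    refine ⟨(Z + r, κ), ?_⟩
    rw [borderedL_apply]
    have hsplit : ((Z + r, a * (Z + r) + κ • e) : Circ × Circ)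
        = (Z, a * Z + κ • e + b) + (r, r 0 • (1 : Circ)) := by
      rw [Prod.mk_add_mk, hb]
      congr 1
      rw [mul_add]
      abel
    rw [hsplit, map_add, hZ0, hr, zero_add, mul_add, map_add]
    have : meanL (w * Z) = s - meanL (w * r) := by
      rw [← hzi]; simp [meanL_apply, hZ]
    rw [this, sub_add_cancel]

/-- Existence of a smooth family `(Y, c)` of solutions of the bordered problem near `x₀`, with its
derivative in the direction `ξ`. -/
theorem exists_smooth_family {hc A : ℝ} {x₀ e w : Circ} (he : ∀ x, 0 < e x) (hw : ∀ x, 0 < w x)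
    (hx₀ : ∀ t : ℝ, HasDerivAt (fun t : ℝ => x₀ (t : UnitAddCircle))
        (cubic (x₀ (t : UnitAddCircle)) + hc * Real.cos (2 * Real.pi * t)) t) :
    ∃ (Y : ℝ × ℝ → Circ) (c : ℝ × ℝ → ℝ), ContDiffAt ℝ ∞ Y (0, hc) ∧ ContDiffAt ℝ ∞ c (0, hc) ∧
      Y (0, hc) = x₀ ∧ c (0, hc) = 0 ∧
      (∀ᶠ p in 𝓝 ((0 : ℝ), hc),
        (∀ t : ℝ, HasDerivAt (fun t : ℝ => Y p (t : UnitAddCircle))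
          (cubic (Y p (t : UnitAddCircle)) + p.2 * Real.cos (2 * Real.pi * t)
            + c p * e (t : UnitAddCircle)) t) ∧
        ∫ t in (0 : ℝ)..1, w (t : UnitAddCircle)
          * (Y p (t : UnitAddCircle) - x₀ (t : UnitAddCircle)) = A * p.1) ∧
      ∃ (η : Circ) (κ : ℝ), HasDerivAt (fun ξ => Y (ξ, hc)) η 0 ∧
        borderedL x₀ e w (η, κ) = (0, A) := by
  set u : (ℝ × ℝ) × (Circ × ℝ) := ((0, hc), (x₀, 0)) with hu
  have hcd : ContDiffAt ℝ ∞ (bordered x₀ e w A) u := (contDiff_bordered x₀ e w A).contDiffAt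
  have hn : (∞ : WithTop ℕ∞) ≠ 0 := by simp
  have hfd : HasFDerivAt (bordered x₀ e w A) (fderiv ℝ (bordered x₀ e w A) u) u :=
    (hcd.differentiableAt hn).hasFDerivAt
  have hpart : fderiv ℝ (bordered x₀ e w A) u ∘L .inr ℝ (ℝ × ℝ) (Circ × ℝ)
      = borderedL x₀ e w := by
    refine HasFDerivAt.unique ?_ (hasFDerivAt_bordered x₀ e w A (0, hc))
    exact HasFDerivAt.comp (x₀, (0 : ℝ)) (f := fun q : Circ × ℝ => (((0 : ℝ), hc), q)) hfd
      (hasFDerivAt_prodMk_right _ _)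
  have hinv : (fderiv ℝ (bordered x₀ e w A) u ∘L .inr ℝ (ℝ × ℝ) (Circ × ℝ)).IsInvertible := by
    rw [hpart]
    have hb := bijective_borderedL x₀ he hw
    exact ⟨ContinuousLinearEquiv.ofBijective (borderedL x₀ e w)
      (LinearMap.ker_eq_bot.2 hb.1) (LinearMap.range_eq_top.2 hb.2), by ext <;> rfl⟩
  set ψ := hcd.implicitFunction hn hinv with hψ
  have hψ0 : ψ (0, hc) = (x₀, 0) := hcd.implicitFunction_apply_self hn hinv
  have hψc : ContDiffAt ℝ ∞ ψ (0, hc) := hcd.contDiffAt_implicitFunction hn hinv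
  have hbase : bordered x₀ e w A u = 0 := by
    rw [hu, bordered_eq_zero_iff]
    exact ⟨fun t => by simpa using hx₀ t, by simp⟩
  have hev : ∀ᶠ p in 𝓝 ((0 : ℝ), hc), bordered x₀ e w A (p, ψ p) = 0 := by
    have := hcd.eventually_apply_implicitFunction hn hinv
    rwa [hbase] at this
  refine ⟨fun p => (ψ p).1, fun p => (ψ p).2, hψc.fst, hψc.snd, by simp [hψ0], by simp [hψ0],
    ?_, ?_⟩
  · filter_upwards [hev] with p hp
    exact (bordered_eq_zero_iff x₀ e w (ψ p).1 A p.1 p.2 (ψ p).2).1 hp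
  · have hline : HasDerivAt (fun ξ : ℝ => (ξ, hc)) ((1 : ℝ), (0 : ℝ)) 0 :=
      (hasDerivAt_id 0).prodMk (hasDerivAt_const 0 hc)
    have hψd : HasDerivAt (fun ξ : ℝ => ψ (ξ, hc)) (fderiv ℝ ψ (0, hc) (1, 0)) 0 :=
      HasFDerivAt.comp_hasDerivAt (0 : ℝ) (hψc.differentiableAt hn).hasFDerivAt hline
    set q := fderiv ℝ ψ (0, hc) (1, 0) with hq
    refine ⟨q.1, q.2, hψd.fst, ?_⟩
    have h1 : HasDerivAt (fun ξ : ℝ => bordered x₀ e w A ((ξ, hc), ψ (ξ, hc)))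
        (fderiv ℝ (bordered x₀ e w A) u ((1, 0), q)) 0 := by
      have hfd' : HasFDerivAt (bordered x₀ e w A) (fderiv ℝ (bordered x₀ e w A) u)
          ((0, hc), ψ (0, hc)) := by rw [hψ0]; exact hfd
      exact HasFDerivAt.comp_hasDerivAt (0 : ℝ) (f := fun ξ : ℝ => ((ξ, hc), ψ (ξ, hc))) hfd'
        (hline.prodMk hψd)
    have h2 : fderiv ℝ (bordered x₀ e w A) u ((1, 0), q) = 0 := by
      refine h1.unique ((hasDerivAt_const (0 : ℝ) (0 : Circ × ℝ)).congr_of_eventuallyEq ?_)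
      have hcont : Tendsto (fun ξ : ℝ => (ξ, hc)) (𝓝 0) (𝓝 (0, hc)) :=
        hline.continuousAt
      exact hcont.eventually hev
    have h3 : HasDerivAt (fun ξ : ℝ => bordered x₀ e w A ((ξ, hc), (x₀, 0)))
        (fderiv ℝ (bordered x₀ e w A) u ((1, 0), 0)) 0 := by
      refine HasFDerivAt.comp_hasDerivAt (0 : ℝ)
        (f := fun ξ : ℝ => ((ξ, hc), ((x₀, 0) : Circ × ℝ))) hfd
        (hline.prodMk (hasDerivAt_const _ _))
    have h4 : fderiv ℝ (bordered x₀ e w A) u ((1, 0), 0) = (0, -A) := by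
      refine h3.unique ?_
      unfold bordered
      refine (hasDerivAt_const (0 : ℝ) (odeL (x₀, x₀ - x₀ ^ 3 + hc • cosC + (0 : ℝ) • e))).prodMk ?_
      simpa using ((hasDerivAt_id (0 : ℝ)).const_mul A).const_sub (meanL (w * (x₀ - x₀)))
    have h5 : borderedL x₀ e w q = fderiv ℝ (bordered x₀ e w A) u ((0, 0), q) := by
      rw [← hpart]; rfl
    have h6 : (((1 : ℝ), (0 : ℝ)), q) = (((1 : ℝ), (0 : ℝ)), (0 : Circ × ℝ))
        + (((0 : ℝ), (0 : ℝ)), q) := by simp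
    rw [h6, map_add, h4, ← h5] at h2
    rw [Prod.mk.eta, ← neg_eq_iff_add_eq_zero.2 h2]
    simp

/-! ### Periodic solutions of the cubic equation with an additional forcing term -/

/-- The divided difference `(f x - f y) / (x - y)` of `f(x) = x - x³`. -/
def divDiff (x y : ℝ) : ℝ := 1 - (x ^ 2 + x * y + y ^ 2)

lemma cubic_sub_cubic (x y : ℝ) : cubic y - cubic x = divDiff x y * (y - x) := by
  simp only [cubic, divDiff]; ring

lemma divDiff_le_one (x y : ℝ) : divDiff x y ≤ 1 := by
  simp only [divDiff]; nlinarith [sq_nonneg (x + y), sq_nonneg x, sq_nonneg y]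

@[fun_prop] lemma continuous_divDiff {x y : ℝ → ℝ} (hx : Continuous x) (hy : Continuous y) :
    Continuous fun t => divDiff (x t) (y t) := by
  unfold divDiff; fun_prop

lemma deriv_cubic (x : ℝ) : deriv cubic x = 1 - 3 * x ^ 2 := by
  have : HasDerivAt cubic (1 - 3 * x ^ 2) x := by
    simpa [cubic] using! (hasDerivAt_id x).sub ((hasDerivAt_id x).pow 3)
  exact this.deriv

lemma cos_add_half (t : ℝ) :
    Real.cos (2 * Real.pi * (t + 1 / 2)) = -Real.cos (2 * Real.pi * t) := by
  rw [← Real.cos_add_pi]; congr 1; ring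

/-- `x` is a 1-periodic solution of `x' = x - x³ + h cos(2πt) + c e(t)`. -/
def IsForced (h c : ℝ) (e x : ℝ → ℝ) : Prop :=
  (∀ t, HasDerivAt x (cubic (x t) + h * Real.cos (2 * Real.pi * t) + c * e t) t) ∧
    Function.Periodic x 1

lemma isPeriodicSolution_iff {h : ℝ} (e : ℝ → ℝ) {x : ℝ → ℝ} :
    IsPeriodicSolution cubic h x ↔ IsForced h 0 e x := by
  simp [IsPeriodicSolution, SolvesOn, IsForced]

namespace IsForced

variable {h c c' : ℝ} {e w x y : ℝ → ℝ}

lemma continuous (hx : IsForced h c e x) : Continuous x :=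
  continuous_iff_continuousAt.2 fun t => (hx.1 t).continuousAt

lemma hasDerivAt_sub (hx : IsForced h c e x) (hy : IsForced h c' e y) (t : ℝ) :
    HasDerivAt (fun t => y t - x t)
      (divDiff (x t) (y t) * (y t - x t) + (c' - c) * e t) t := by
  refine ((hy.1 t).sub (hx.1 t)).congr_deriv ?_
  linear_combination cubic_sub_cubic (x t) (y t)

lemma periodic_sub (hx : IsForced h c e x) (hy : IsForced h c' e y) :
    Function.Periodic (fun t => y t - x t) 1 := fun t => by
  simp [hx.2 t, hy.2 t]

/-- The weighted mean determines both the solution and the strength `c` of the forcing. -/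
lemma unique (he : ∀ t, 0 < e t) (hw : Continuous w) (hw0 : ∀ t, 0 < w t)
    (hx : IsForced h c e x) (hy : IsForced h c' e y)
    (hint : ∫ t in (0 : ℝ)..1, w t * (y t - x t) = 0) : c = c' ∧ x = y := by
  have := eq_zero_of_periodic_of_integral_eq_zero (continuous_divDiff hx.continuous hy.continuous)
    he (hx.hasDerivAt_sub hy) (hx.periodic_sub hy) hw hw0 hint
  exact ⟨by linarith [this.1], funext fun t => by linarith [this.2 t]⟩

/-- Solutions of the forced equation are ordered by their weighted means. -/
lemma lt (he : ∀ t, 0 < e t) (hw : Continuous w) (hw0 : ∀ t, 0 < w t)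
    (hx : IsForced h c e x) (hy : IsForced h c' e y)
    (hint : 0 < ∫ t in (0 : ℝ)..1, w t * (y t - x t)) (t : ℝ) : x t < y t :=
  sub_pos.1 <| pos_of_periodic_of_integral_pos (continuous_divDiff hx.continuous hy.continuous)
    he (hx.hasDerivAt_sub hy) (hx.periodic_sub hy) hw hw0 hint t

/-- The symmetry `x(t) ↦ -x(t + 1/2)`. -/
lemma mirror (he : ∀ t, e (t + 1 / 2) = e t) (hx : IsForced h c e x) :
    IsForced h (-c) e fun t => -x (t + 1 / 2) := by
  refine ⟨fun t => ?_, fun t => ?_⟩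
  · refine ((hx.1 (t + 1 / 2)).comp_add_const t (1 / 2)).neg.congr_deriv ?_
    rw [cos_add_half, he]
    simp only [cubic]
    ring
  · have := hx.2 (t + 1 / 2)
    simp only
    rw [← this]
    congr 2
    ring

end IsForced

lemma periodic_of_add_half {w : ℝ → ℝ} (hw : ∀ t, w (t + 1 / 2) = w t) :
    Function.Periodic w 1 := fun t => by
  rw [show t + 1 = t + 1 / 2 + 1 / 2 by ring, hw, hw]

lemma integral_half_shift {x : ℝ → ℝ} (hx : Function.Periodic x 1) :
    ∫ t in (0 : ℝ)..1, x (t + 1 / 2) = ∫ t in (0 : ℝ)..1, x t := by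
  rw [intervalIntegral.integral_comp_add_right]
  have := hx.intervalIntegral_add_eq (1 / 2) 0
  rw [zero_add] at this
  rw [← this]
  congr 1 <;> ring

section periodic

variable {h : ℝ} {x y z : ℝ → ℝ}

lemma IsPeriodicSolution.isForced (hx : IsPeriodicSolution cubic h x) (e : ℝ → ℝ) :
    IsForced h 0 e x := (isPeriodicSolution_iff e).1 hx

lemma IsPeriodicSolution.continuous (hx : IsPeriodicSolution cubic h x) : Continuous x :=
  (hx.isForced fun _ => 1).continuous

lemma IsPeriodicSolution.hasDerivAt (hx : IsPeriodicSolution cubic h x) (t : ℝ) :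
    HasDerivAt x (cubic (x t) + h * Real.cos (2 * Real.pi * t)) t := by
  simpa using (hx.isForced fun _ => 1).1 t

lemma IsPeriodicSolution.mirror (hx : IsPeriodicSolution cubic h x) :
    IsPeriodicSolution cubic h fun t => -x (t + 1 / 2) := by
  have := (hx.isForced fun _ => 1).mirror (fun _ => rfl)
  rw [neg_zero] at this
  exact (isPeriodicSolution_iff _).2 this

/-- Periodic solutions do not cross. -/
lemma IsPeriodicSolution.eq_or_lt_or_lt (hx : IsPeriodicSolution cubic h x)
    (hy : IsPeriodicSolution cubic h y) : x = y ∨ (∀ t, x t < y t) ∨ ∀ t, y t < x t := by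
  have hx' := hx.isForced fun _ => 1
  have hy' := hy.isForced fun _ => 1
  have hneg : ∫ t in (0 : ℝ)..1, 1 * (x t - y t) = -∫ t in (0 : ℝ)..1, 1 * (y t - x t) := by
    rw [← intervalIntegral.integral_neg]; congr 1; ext t; ring
  rcases lt_trichotomy (∫ t in (0 : ℝ)..1, 1 * (y t - x t)) 0 with hlt | heq | hgt
  · exact .inr (.inr (hy'.lt (fun _ => one_pos) continuous_const (fun _ => one_pos) hx'
      (by rw [hneg]; linarith)))
  · exact .inl (hx'.unique (fun _ => one_pos) continuous_const (fun _ => one_pos) hy' heq).2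
  · exact .inr (.inl (hx'.lt (fun _ => one_pos) continuous_const (fun _ => one_pos) hy' hgt))

lemma IsZeroMeanSolution.unique (hx : IsZeroMeanSolution cubic h x)
    (hy : IsZeroMeanSolution cubic h y) : x = y := by
  refine ((hx.1.isForced fun _ => 1).unique (w := fun _ => 1) (fun _ => one_pos) continuous_const
    (fun _ => one_pos) (hy.1.isForced fun _ => 1) ?_).2
  simp only [one_mul]
  rw [intervalIntegral.integral_sub (hy.1.continuous.intervalIntegrable _ _)
    (hx.1.continuous.intervalIntegrable _ _), hx.2, hy.2, sub_zero]

lemma IsZeroMeanSolution.mirror (hx : IsZeroMeanSolution cubic h x) :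
    IsZeroMeanSolution cubic h fun t => -x (t + 1 / 2) := by
  refine ⟨hx.1.mirror, ?_⟩
  rw [intervalIntegral.integral_neg, integral_half_shift hx.1.2, hx.2, neg_zero]

lemma IsZeroMeanSolution.antiperiodic (hx : IsZeroMeanSolution cubic h x) (t : ℝ) :
    x (t + 1 / 2) = -x t := by
  have := congrFun (hx.unique hx.mirror) t
  linarith

lemma IsPeriodicSolution.isZeroMeanSolution_of_antiperiodic (hx : IsPeriodicSolution cubic h x)
    (ha : ∀ t, x (t + 1 / 2) = -x t) : IsZeroMeanSolution cubic h x := by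
  refine ⟨hx, ?_⟩
  have := integral_half_shift hx.2
  simp only [ha, intervalIntegral.integral_neg] at this
  linarith

lemma add_half_pos {p : ℝ → ℝ} (hp : ∀ t, 0 < p t) (t : ℝ) : 0 < p t + p (t + 1 / 2) :=
  add_pos (hp _) (hp _)

lemma continuous_ratio {e p : ℝ → ℝ} (hec : Continuous e) (hpc : Continuous p)
    (hp : ∀ t, 0 < p t) : Continuous fun t => e t * (p t ^ 2 + p (t + 1 / 2) ^ 2) /
      (p t * p (t + 1 / 2) * (p t + p (t + 1 / 2))) :=
  Continuous.div (by fun_prop) (by fun_prop) fun t =>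
    (mul_pos (mul_pos (hp _) (hp _)) (add_half_pos hp t)).ne'

lemma integral_ratio_pos {e p : ℝ → ℝ} (hec : Continuous e) (he : ∀ t, 0 < e t)
    (hpc : Continuous p) (hp : ∀ t, 0 < p t) :
    0 < ∫ t in (0 : ℝ)..1, e t * (p t ^ 2 + p (t + 1 / 2) ^ 2) /
      (p t * p (t + 1 / 2) * (p t + p (t + 1 / 2))) := by
  refine intervalIntegral.intervalIntegral_pos_of_pos
    ((continuous_ratio hec hpc hp).intervalIntegrable _ _) (fun t => ?_) one_pos
  have h1 := he t
  have h2 := hp t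
  have h3 := hp (t + 1 / 2)
  positivity

/-- The key identity. Let `p = y - x > 0`, where `x` is the antiperiodic solution and `y` solves the
equation with additional forcing `c e`, and put `q(t) = p(t + 1/2)`. The quadratic terms of the
equations for `p` and `q` have opposite signs, so that `S = 1/p + 1/q` satisfies
`S'/S = -f'(x) + p q - c e (p² + q²) / (p q (p + q))`; integrate over a period. -/
lemma integral_deriv_cubic_eq {c : ℝ} {e : ℝ → ℝ} (hec : Continuous e)
    (he : ∀ t, e (t + 1 / 2) = e t) (hx : IsZeroMeanSolution cubic h x) (hy : IsForced h c e y)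
    (hxy : ∀ t, x t < y t) :
    ∫ t in (0 : ℝ)..1, deriv cubic (x t) =
      (∫ t in (0 : ℝ)..1, (y t - x t) * (y (t + 1 / 2) - x (t + 1 / 2))) -
      c * ∫ t in (0 : ℝ)..1, e t * ((y t - x t) ^ 2 + (y (t + 1 / 2) - x (t + 1 / 2)) ^ 2) /
        ((y t - x t) * (y (t + 1 / 2) - x (t + 1 / 2))
          * ((y t - x t) + (y (t + 1 / 2) - x (t + 1 / 2)))) := by
  have hx' := hx.1.isForced e
  have hxc := hx.1.continuous
  have hyc := hy.continuous
  set p : ℝ → ℝ := fun t => y t - x t with hp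
  have hp0 : ∀ t, 0 < p t := fun t => sub_pos.2 (hxy t)
  have hpc : Continuous p := hyc.sub hxc
  have hpp : Function.Periodic p 1 := hx'.periodic_sub hy
  have hpd : ∀ t, HasDerivAt p (divDiff (x t) (x t + p t) * p t + c * e t) t := fun t => by
    simpa [hp] using hx'.hasDerivAt_sub hy t
  have hqd : ∀ t, HasDerivAt (fun t => p (t + 1 / 2))
      (divDiff (-x t) (-x t + p (t + 1 / 2)) * p (t + 1 / 2) + c * e t) t := fun t => by
    have := (hpd (t + 1 / 2)).comp_add_const t (1 / 2)
    rwa [hx.antiperiodic, he] at this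
  have hdc : Continuous fun t => deriv cubic (x t) := by
    simp only [deriv_cubic]
    fun_prop
  have hrc := continuous_ratio hec hpc hp0
  have hS := integral_eq_zero_of_periodic_linear
    (m := fun t => (-(deriv cubic (x t)) + p t * p (t + 1 / 2))
      - c * (e t * (p t ^ 2 + p (t + 1 / 2) ^ 2) /
      (p t * p (t + 1 / 2) * (p t + p (t + 1 / 2)))))
    (d := fun t => (p t)⁻¹ + (p (t + 1 / 2))⁻¹) ?_ ?_ ?_ ?_
  · rw [intervalIntegral.integral_sub, intervalIntegral.integral_add,
      intervalIntegral.integral_neg, intervalIntegral.integral_const_mul] at hS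
    · linarith
    all_goals exact Continuous.intervalIntegrable (by fun_prop) _ _
  · fun_prop
  · intro t
    refine (((hpd t).inv (hp0 t).ne').add ((hqd t).inv (hp0 _).ne')).congr_deriv ?_
    have h1 := (hp0 t).ne'
    have h2 := (hp0 (t + 1 / 2)).ne'
    have h3 := (add_half_pos hp0 t).ne'
    generalize p t = P at *
    generalize p (t + 1 / 2) = Q at *
    rw [deriv_cubic]
    simp only [divDiff]
    field_simp
    ring
  · intro t
    have := hpp (t + 1 / 2)
    simp only
    rw [hpp t, ← this]
    congr 3
    ring
  · exact (add_pos (inv_pos.2 (hp0 _)) (inv_pos.2 (hp0 _))).ne'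

/-- A solution above the zero-mean solution satisfies `∫ p(t) p(t + 1/2) = ∫ f'(x)`. -/
lemma IsZeroMeanSolution.integral_deriv_eq_of_lt (hx : IsZeroMeanSolution cubic h x)
    (hy : IsPeriodicSolution cubic h y) (hxy : ∀ t, x t < y t) :
    ∫ t in (0 : ℝ)..1, deriv cubic (x t) =
      ∫ t in (0 : ℝ)..1, (y t - x t) * (y (t + 1 / 2) - x (t + 1 / 2)) := by
  have := integral_deriv_cubic_eq (e := fun _ => 1) continuous_const (fun _ => rfl) hx
    (hy.isForced fun _ => 1) hxy
  rwa [zero_mul, sub_zero] at this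

lemma integral_mul_shift_lt {p q : ℝ → ℝ} (hpc : Continuous p) (hqc : Continuous q)
    (hp : ∀ t, 0 ≤ p t) (hpq : ∀ t, p t < q t) :
    ∫ t in (0 : ℝ)..1, p t * p (t + 1 / 2) < ∫ t in (0 : ℝ)..1, q t * q (t + 1 / 2) := by
  refine intervalIntegral.integral_lt_integral_of_continuousOn_of_le_of_exists_lt one_pos
    (by fun_prop) (by fun_prop) (fun t _ => ?_) ⟨0, by simp, ?_⟩
  · exact mul_le_mul (hpq _).le (hpq _).le (hp _) ((hp t).trans (hpq t).le)
  · exact mul_lt_mul'' (hpq _) (hpq _) (hp _) (hp _)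

/-- At most one periodic solution lies above the zero-mean solution. -/
lemma IsZeroMeanSolution.eq_of_lt_of_lt (hx : IsZeroMeanSolution cubic h x)
    (hy : IsPeriodicSolution cubic h y) (hz : IsPeriodicSolution cubic h z)
    (hxy : ∀ t, x t < y t) (hxz : ∀ t, x t < z t) : y = z := by
  have key : ∀ {y z : ℝ → ℝ}, IsPeriodicSolution cubic h y → IsPeriodicSolution cubic h z →
      (∀ t, x t < y t) → (∀ t, x t < z t) → ¬ ∀ t, y t < z t := by
    intro y z hy hz hxy hxz hyz
    have h1 := hx.integral_deriv_eq_of_lt hy hxy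
    have h2 := hx.integral_deriv_eq_of_lt hz hxz
    have h3 := integral_mul_shift_lt (hy.continuous.sub hx.1.continuous)
      (hz.continuous.sub hx.1.continuous) (fun t => (sub_pos.2 (hxy t)).le)
      (fun t => sub_lt_sub_right (hyz t) _)
    simp only [Pi.sub_apply] at h3
    linarith
  rcases hy.eq_or_lt_or_lt hz with h1 | h1 | h1
  · exact h1
  · exact absurd h1 (key hy hz hxy hxz)
  · exact absurd h1 (key hz hy hxz hxy)

/-- If `∫ f'(x) ≤ 0` then the zero-mean solution `x` is the only periodic solution. -/
lemma IsZeroMeanSolution.eq_of_integral_nonpos (hx : IsZeroMeanSolution cubic h x)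
    (hl : ∫ t in (0 : ℝ)..1, deriv cubic (x t) ≤ 0) (hy : IsPeriodicSolution cubic h y) :
    y = x := by
  have key : ∀ {y : ℝ → ℝ}, IsPeriodicSolution cubic h y → ¬ ∀ t, x t < y t := by
    intro y hy hxy
    rw [hx.integral_deriv_eq_of_lt hy hxy] at hl
    refine absurd hl (not_le.2 ?_)
    have hc := hy.continuous.sub hx.1.continuous
    exact integral_mul_pos (w := fun t => y t - x t)
      (d := fun t => y (t + 1 / 2) - x (t + 1 / 2)) hc (fun t => sub_pos.2 (hxy t))
      (hc.comp (continuous_id.add continuous_const)) (fun t => sub_pos.2 (hxy _))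
  rcases hx.1.eq_or_lt_or_lt hy with h1 | h1 | h1
  · exact h1.symm
  · exact absurd h1 (key hy)
  · refine absurd (fun t => ?_) (key hy.mirror)
    have := h1 (t + 1 / 2)
    rw [hx.antiperiodic] at this
    linarith

lemma integral_divDiff_eq_zero (hx : IsPeriodicSolution cubic h x)
    (hy : IsPeriodicSolution cubic h y) (hxy : x 0 ≠ y 0) :
    ∫ t in (0 : ℝ)..1, divDiff (x t) (y t) = 0 :=
  integral_eq_zero_of_periodic_linear (continuous_divDiff hx.continuous hy.continuous)
    (fun t => by simpa using (hx.isForced fun _ => 1).hasDerivAt_sub (hy.isForced fun _ => 1) t)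
    ((hx.isForced fun _ => 1).periodic_sub (hy.isForced fun _ => 1)) (sub_ne_zero.2 hxy.symm)

/-- The largest of three periodic solutions has a negative Floquet exponent: the divided
differences of `f` have mean zero, and `f'(x) + (x - y) (x - z)` is a linear combination of them. -/
lemma integral_deriv_cubic_neg_of_largest (hx : IsPeriodicSolution cubic h x)
    (hy : IsPeriodicSolution cubic h y) (hz : IsPeriodicSolution cubic h z)
    (hyz : ∀ t, y t < z t) (hzx : ∀ t, z t < x t) :
    ∫ t in (0 : ℝ)..1, deriv cubic (x t) < 0 := by
  have hxc := hx.continuous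
  have hyc := hy.continuous
  have hzc := hz.continuous
  have h1 := integral_divDiff_eq_zero hx hy ((hyz 0).trans (hzx 0)).ne'
  have h2 := integral_divDiff_eq_zero hx hz (hzx 0).ne'
  have h3 := integral_divDiff_eq_zero hy hz (hyz 0).ne
  have h4 := integral_mul_pos (hxc.sub hyc) (fun t => sub_pos.2 ((hyz t).trans (hzx t)))
    (hxc.sub hzc) (fun t => sub_pos.2 (hzx t))
  have h5 : ∫ t in (0 : ℝ)..1, (divDiff (x t) (y t) + divDiff (x t) (z t) - divDiff (y t) (z t))
      = 0 := by
    rw [intervalIntegral.integral_sub, intervalIntegral.integral_add, h1, h2, h3]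
    · simp
    all_goals exact Continuous.intervalIntegrable (by fun_prop) _ _
  have h6 : ∀ t, deriv cubic (x t) = (divDiff (x t) (y t) + divDiff (x t) (z t)
      - divDiff (y t) (z t)) - (x t - y t) * (x t - z t) := fun t => by
    rw [deriv_cubic]; simp only [divDiff]; ring
  simp only [h6]
  rw [intervalIntegral.integral_sub, h5]
  · simpa using h4
  all_goals exact Continuous.intervalIntegrable (by fun_prop) _ _

end periodic

/-! ### Stability -/

lemma exists_abs_le_of_periodic {f : ℝ → ℝ} (hf : Continuous f) (hp : Function.Periodic f 1) :
    ∃ K, 0 ≤ K ∧ ∀ t, |f t| ≤ K :=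
  ⟨‖toCirc f hf hp‖, norm_nonneg _, fun t => by
    simpa using (toCirc f hf hp).norm_coe_le_norm (t : UnitAddCircle)⟩

section

variable {h T : ℝ} {x y : ℝ → ℝ}

/-- The difference of two solutions on `[0, T]`. The continuous function `m` extends the divided
difference beyond `[0, T]`. -/
lemma SolvesOn.exists_sub_eq_exp (hx : IsPeriodicSolution cubic h x) (hT : 0 ≤ T)
    (hy : SolvesOn cubic h y (Icc 0 T)) :
    ∃ m : ℝ → ℝ, Continuous m ∧ (∀ t, m t ≤ 1) ∧ (∀ t ∈ Icc 0 T, m t = divDiff (x t) (y t)) ∧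
      ∀ t ∈ Icc 0 T, y t - x t = (y 0 - x 0) * Real.exp (∫ s in (0 : ℝ)..t, m s) := by
  have hyc : ContinuousOn y (Icc 0 T) := fun t ht => (hy t ht).continuousWithinAt
  have hec : Continuous (IccExtend hT ((Icc 0 T).domRestrict y)) :=
    (continuousOn_iff_continuous_domRestrict.1 hyc).Icc_extend'
  have heq : ∀ t ∈ Icc 0 T, divDiff (x t) (IccExtend hT ((Icc 0 T).domRestrict y) t)
      = divDiff (x t) (y t) := fun t ht => by rw [IccExtend_of_mem hT _ ht]; rfl
  have hmc := continuous_divDiff hx.continuous hec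
  refine ⟨_, hmc, fun t => divDiff_le_one _ _, heq, fun t ht => ?_⟩
  refine eq_mul_exp_of_linear_Icc (d := fun t => y t - x t) hmc (fun s hs => ?_) ht
  refine ((hy s hs).sub (hx.hasDerivAt s).hasDerivWithinAt).congr_deriv ?_
  rw [heq s hs]
  linear_combination cubic_sub_cubic (x s) (y s)

lemma SolvesOn.neg {s : Set ℝ} (hy : SolvesOn cubic h y s) :
    SolvesOn cubic (-h) (fun t => -y t) s := fun t ht =>
  (hy t ht).neg.congr_deriv (by simp only [cubic]; ring)

lemma IsZeroMeanSolution.neg (hx : IsZeroMeanSolution cubic h x) :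
    IsZeroMeanSolution cubic (-h) fun t => -x t :=
  ⟨⟨SolvesOn.neg hx.1.1, fun t => by simp [hx.1.2 t]⟩, by
    rw [intervalIntegral.integral_neg, hx.2, neg_zero]⟩

lemma continuous_deriv_cubic (hx : Continuous x) : Continuous fun t => deriv cubic (x t) := by
  simp only [deriv_cubic]
  fun_prop

/-- The zero-mean solution is antiperiodic and `f'` is even, so each half period contributes half
of the exponent. -/
lemma IsZeroMeanSolution.integral_half (hx : IsZeroMeanSolution cubic h x) (t : ℝ) :
    ∫ s in t..(t + 1 / 2), deriv cubic (x s) =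
      (∫ s in (0 : ℝ)..1, deriv cubic (x s)) / 2 := by
  have hc := continuous_deriv_cubic hx.1.continuous
  have hp : Function.Periodic (fun s => deriv cubic (x s)) (1 / 2) := fun s => by
    simp only [deriv_cubic, hx.antiperiodic]
    ring
  have h1 := hp.intervalIntegral_add_eq t 0
  have h2 := hp.intervalIntegral_add_eq (1 / 2) 0
  have h3 := intervalIntegral.integral_add_adjacent_intervals
    (hc.intervalIntegrable (μ := MeasureTheory.volume) 0 (1 / 2))
    (hc.intervalIntegrable (1 / 2) 1)
  norm_num at h1 h2 h3 ⊢
  linarith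

/-- If `∫ f'(x) ≤ 0`, the distance `p` of a solution above the zero-mean solution `x` does not grow
over a period: `S(t) = 1/p(t) + 1/p(t + 1/2)` does not decrease over half a period. -/
lemma IsZeroMeanSolution.sub_add_one_le (hx : IsZeroMeanSolution cubic h x)
    (hl : ∫ t in (0 : ℝ)..1, deriv cubic (x t) ≤ 0) (hT : 0 ≤ T)
    (hy : SolvesOn cubic h y (Icc 0 T)) (h0 : x 0 < y 0) {t : ℝ} (ht : 0 ≤ t) (htT : t + 1 ≤ T) :
    y (t + 1) - x (t + 1) ≤ y t - x t := by
  obtain ⟨m, -, -, -, hm⟩ := SolvesOn.exists_sub_eq_exp hx.1 hT hy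
  set p : ℝ → ℝ := fun t => y t - x t with hp
  have hp0 : ∀ s ∈ Icc 0 T, 0 < p s := fun s hs => by
    simp only [hp]
    rw [hm s hs]
    exact mul_pos (sub_pos.2 h0) (Real.exp_pos _)
  have hpd : ∀ s ∈ Ioo 0 T, HasDerivAt p (divDiff (x s) (x s + p s) * p s) s := fun s hs => by
    have h1 := ((hy s (Ioo_subset_Icc_self hs)).hasDerivAt (Icc_mem_nhds hs.1 hs.2)).sub
      (hx.1.hasDerivAt s)
    refine h1.congr_deriv ?_
    simp only [hp]
    rw [show x s + (y s - x s) = y s by ring]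
    linear_combination cubic_sub_cubic (x s) (y s)
  have hac := continuous_deriv_cubic hx.1.continuous
  have hpc : ContinuousOn p (Icc 0 T) :=
    ContinuousOn.sub (fun s hs => (hy s hs).continuousWithinAt) hx.1.continuous.continuousOn
  set S : ℝ → ℝ := fun s => ((p s)⁻¹ + (p (s + 1 / 2))⁻¹) *
    Real.exp (∫ r in (0 : ℝ)..s, deriv cubic (x r)) with hS
  have hmem : ∀ s ∈ Icc 0 (T - 1 / 2), s ∈ Icc 0 T ∧ s + 1 / 2 ∈ Icc 0 T := fun s hs =>
    ⟨⟨hs.1, by linarith [hs.2]⟩, ⟨by linarith [hs.1], by linarith [hs.2]⟩⟩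
  have hmono : MonotoneOn S (Icc 0 (T - 1 / 2)) := by
    refine monotoneOn_of_hasDerivWithinAt_nonneg (convex_Icc _ _) ?_
      (f' := fun s => (p s + p (s + 1 / 2)) * Real.exp (∫ r in (0 : ℝ)..s, deriv cubic (x r))) ?_ ?_
    · refine ContinuousOn.mul (ContinuousOn.add ?_ ?_)
        (Real.continuous_exp.comp (continuous_primitive hac)).continuousOn
      · exact (hpc.mono fun s hs => (hmem s hs).1).inv₀
          fun s hs => (hp0 s (hmem s hs).1).ne'
      · exact (hpc.comp (by fun_prop) fun s hs => (hmem s hs).2).inv₀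
          fun s hs => (hp0 _ (hmem s hs).2).ne'
    · intro s hs
      rw [interior_Icc] at hs
      have hs1 : s ∈ Ioo 0 T := ⟨hs.1, by linarith [hs.2]⟩
      have hs2 : s + 1 / 2 ∈ Ioo 0 T := ⟨by linarith [hs.1], by linarith [hs.2]⟩
      have h1 := (hp0 s (Ioo_subset_Icc_self hs1)).ne'
      have h2 := (hp0 _ (Ioo_subset_Icc_self hs2)).ne'
      have hq := (hpd _ hs2).comp_add_const s (1 / 2)
      rw [hx.antiperiodic] at hq
      refine (((((hpd s hs1).inv h1).add (hq.inv h2)).mul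
        (hasDerivAt_primitive hac s).exp).congr_deriv ?_).hasDerivWithinAt
      simp only [Pi.add_apply, Pi.inv_apply]
      generalize Real.exp _ = E
      generalize p s = P at *
      generalize p (s + 1 / 2) = Q at *
      rw [deriv_cubic]
      simp only [divDiff]
      field_simp
      ring
    · intro s hs
      have := hmem s (interior_subset hs)
      exact mul_nonneg (add_pos (hp0 _ this.1) (hp0 _ this.2)).le (Real.exp_pos _).le
  have hle := hmono (a := t) (b := t + 1 / 2) ⟨ht, by linarith⟩ ⟨by linarith, by linarith⟩
    (by linarith)
  have hexp : Real.exp (∫ r in (0 : ℝ)..(t + 1 / 2), deriv cubic (x r)) ≤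
      Real.exp (∫ r in (0 : ℝ)..t, deriv cubic (x r)) := by
    refine Real.exp_le_exp.2 ?_
    rw [← intervalIntegral.integral_add_adjacent_intervals (hac.intervalIntegrable 0 t)
      (hac.intervalIntegrable t (t + 1 / 2)), hx.integral_half]
    linarith
  have h1 := hp0 t ⟨ht, by linarith⟩
  have h2 := hp0 (t + 1 / 2) ⟨by linarith, by linarith⟩
  have h3 := hp0 (t + 1) ⟨by linarith, by linarith⟩
  simp only [hS] at hle
  rw [show t + 1 / 2 + 1 / 2 = t + 1 by ring] at hle
  have h4 : (p t)⁻¹ + (p (t + 1 / 2))⁻¹ ≤ (p (t + 1 / 2))⁻¹ + (p (t + 1))⁻¹ := by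
    refine le_of_mul_le_mul_right (hle.trans ?_)
      (Real.exp_pos (∫ r in (0 : ℝ)..t, deriv cubic (x r)))
    exact mul_le_mul_of_nonneg_left hexp (add_pos (inv_pos.2 h2) (inv_pos.2 h3)).le
  exact (inv_le_inv₀ h1 h3).1 (by linarith)

/-- A solution above the zero-mean one stays within `exp 1` times its initial distance: the
distance grows at most by this factor over the first period, since `f' ≤ 1`, and not at all from
one period to the next. -/
lemma IsZeroMeanSolution.sub_le_exp_mul (hx : IsZeroMeanSolution cubic h x)
    (hl : ∫ t in (0 : ℝ)..1, deriv cubic (x t) ≤ 0) (hT : 0 ≤ T)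
    (hy : SolvesOn cubic h y (Icc 0 T)) (h0 : x 0 < y 0) {t : ℝ} (ht : t ∈ Icc 0 T) :
    0 < y t - x t ∧ y t - x t ≤ Real.exp 1 * (y 0 - x 0) := by
  obtain ⟨m, hmc, hm1, -, hm⟩ := SolvesOn.exists_sub_eq_exp hx.1 hT hy
  refine ⟨by rw [hm t ht]; exact mul_pos (sub_pos.2 h0) (Real.exp_pos _), ?_⟩
  have key : ∀ n : ℕ, ∀ t, 0 ≤ t → t ≤ 1 → t + n ≤ T →
      y (t + n) - x (t + n) ≤ Real.exp 1 * (y 0 - x 0) := by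
    intro n
    induction n with
    | zero =>
      intro t ht0 ht1 htT
      rw [Nat.cast_zero, add_zero] at *
      rw [hm t ⟨ht0, htT⟩, mul_comm]
      refine mul_le_mul_of_nonneg_right (Real.exp_le_exp.2 ?_) (sub_pos.2 h0).le
      have := intervalIntegral.integral_mono_on (μ := MeasureTheory.volume) ht0
        (hmc.intervalIntegrable _ _) (continuous_const.intervalIntegrable _ _)
        (fun s _ => hm1 s)
      rw [intervalIntegral.integral_const] at this
      simp only [sub_zero, smul_eq_mul, mul_one] at this
      linarith
    | succ n ih =>
      intro t ht0 ht1 htT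
      push_cast at htT ⊢
      rw [← add_assoc] at htT ⊢
      have hn : (0 : ℝ) ≤ n := n.cast_nonneg
      exact (hx.sub_add_one_le hl hT hy h0 (add_nonneg ht0 hn) htT).trans
        (ih t ht0 ht1 (by linarith))
  have := key ⌊t⌋₊ (t - ⌊t⌋₊) (sub_nonneg.2 (Nat.floor_le ht.1))
    (by linarith [Nat.lt_floor_add_one t]) (by linarith [ht.2])
  rwa [sub_add_cancel] at this

/-- The zero-mean solution is Lyapunov stable as soon as its Floquet exponent is nonpositive; the
cubic term decides in the degenerate case. -/
lemma IsZeroMeanSolution.isLyapunovStable (hx : IsZeroMeanSolution cubic h x)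
    (hl : ∫ t in (0 : ℝ)..1, deriv cubic (x t) ≤ 0) : IsLyapunovStable cubic h x := by
  intro ε hε
  refine ⟨ε * Real.exp (-1), by positivity, fun T y hT hy h0 t ht => ?_⟩
  have hexp : Real.exp 1 * (ε * Real.exp (-1)) = ε := by
    rw [mul_left_comm, ← Real.exp_add]; simp
  have he : 0 < Real.exp 1 := Real.exp_pos 1
  rcases lt_trichotomy (x 0) (y 0) with h1 | h1 | h1
  · obtain ⟨h2, h3⟩ := hx.sub_le_exp_mul hl hT.le hy h1 ht
    rw [abs_of_pos (sub_pos.2 h1)] at h0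
    rw [abs_of_pos h2]
    calc _ ≤ _ := h3
      _ < Real.exp 1 * (ε * Real.exp (-1)) := by gcongr
      _ = ε := hexp
  · obtain ⟨m, -, -, -, hm⟩ := SolvesOn.exists_sub_eq_exp hx.1 hT.le hy
    rw [hm t ht, h1]
    simpa using hε
  · have hl' : ∫ t in (0 : ℝ)..1, deriv cubic (-x t) ≤ 0 := by
      simpa only [deriv_cubic, neg_sq] using hl
    obtain ⟨h2, h3⟩ := hx.neg.sub_le_exp_mul hl' hT.le (SolvesOn.neg hy) (neg_lt_neg h1) ht
    rw [abs_sub_comm, abs_of_pos (sub_pos.2 h1)] at h0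
    rw [abs_sub_comm, abs_of_pos (by linarith)]
    calc x t - y t ≤ Real.exp 1 * (x 0 - y 0) := by
          rw [show x 0 - y 0 = -y 0 - -x 0 by ring]; linarith
      _ < Real.exp 1 * (ε * Real.exp (-1)) := by gcongr
      _ = ε := hexp

end

/-! ### Existence of solutions and instability -/

section

variable {h T : ℝ} {x y : ℝ → ℝ}

lemma hasDerivWithinAt_Ici_of_Icc {f : ℝ → ℝ} {f' t : ℝ} (ht : t ∈ Ico 0 T)
    (hf : HasDerivWithinAt f f' (Icc 0 T) t) : HasDerivWithinAt f f' (Ici t) t :=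
  hf.mono_of_mem_nhdsWithin (Icc_mem_nhdsGE_of_mem ht)

/-- Solutions exist on every interval `[0, T]`: truncate the nonlinearity outside `[-R, R]`; for
large `R` the vector field points inwards at `±R`, so the truncation is not noticed. -/
lemma exists_solvesOn_Icc (h y₀ : ℝ) (hT : 0 ≤ T) :
    ∃ y : ℝ → ℝ, y 0 = y₀ ∧ SolvesOn cubic h y (Icc 0 T) := by
  obtain ⟨R, hR2, hRh, hRy⟩ : ∃ R : ℝ, 2 ≤ R ∧ |h| ≤ R ∧ |y₀| ≤ R :=
    ⟨max 2 (max |h| |y₀|), le_max_left _ _, (le_max_left _ _).trans (le_max_right _ _),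
      (le_max_right _ _).trans (le_max_right _ _)⟩
  set cl : ℝ → ℝ := fun z => max (min z R) (-R) with hcl
  have hclR : ∀ z, |cl z| ≤ R := fun z => abs_le.2
    ⟨le_max_right _ _, max_le (min_le_right _ _) (by linarith)⟩
  have hclip : ∀ z w, |cl z - cl w| ≤ |z - w| := fun z w =>
    (abs_max_sub_max_le_abs _ _ _).trans (by
      simpa using abs_min_sub_min_le_max z R w R)
  have hcos : ∀ t, |h * Real.cos (2 * Real.pi * t)| ≤ R := fun t => by
    rw [abs_mul]
    exact (mul_le_of_le_one_right (abs_nonneg _) (Real.abs_cos_le_one _)).trans hRh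
  have hR0 : 0 ≤ R := by linarith
  have hsq : ∀ z, |z| ≤ R → z ^ 2 ≤ R ^ 2 := fun z hz => sq_le_sq.2 (by rwa [abs_of_nonneg hR0])
  have hPL : IsPicardLindelof (fun t z => cubic (cl z) + h * Real.cos (2 * Real.pi * t))
      (⟨0, left_mem_Icc.2 hT⟩ : Icc (0 : ℝ) T) y₀
      (Real.toNNReal ((R * (1 + R ^ 2) + R) * T)) 0
      (Real.toNNReal (R * (1 + R ^ 2) + R)) (Real.toNNReal (1 + 3 * R ^ 2)) := by
    refine ⟨fun t _ => ?_, fun z _ => by fun_prop, fun t _ z _ => ?_, ?_⟩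
    · refine (LipschitzWith.of_dist_le_mul fun z w => ?_).lipschitzOnWith
      rw [Real.dist_eq, Real.dist_eq, Real.coe_toNNReal _ (by positivity), add_sub_add_right_eq_sub,
        cubic_sub_cubic, abs_mul]
      refine mul_le_mul ?_ (hclip z w) (abs_nonneg _) (by positivity)
      have h1 := hsq _ (hclR z)
      have h2 := hsq _ (hclR w)
      rw [abs_le]
      simp only [divDiff]
      constructor <;> nlinarith [sq_nonneg (cl z - cl w), sq_nonneg (cl z + cl w)]
    · rw [Real.coe_toNNReal _ (by positivity), Real.norm_eq_abs]
      refine (abs_add_le _ _).trans (add_le_add ?_ (hcos t))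
      rw [show cubic (cl z) = cl z * (1 - cl z ^ 2) by simp only [cubic]; ring, abs_mul]
      refine mul_le_mul (hclR z) ?_ (abs_nonneg _) hR0
      have h1 := hsq _ (hclR z)
      rw [abs_le]
      constructor <;> nlinarith [sq_nonneg (cl z)]
    · rw [Real.coe_toNNReal _ (by positivity), Real.coe_toNNReal _ (by positivity)]
      simp [hT]
  obtain ⟨y, hy0, hy⟩ := hPL.exists_eq_forall_mem_Icc_hasDerivWithinAt₀
  simp only at hy0
  have hyc : ContinuousOn y (Icc 0 T) := fun t ht => (hy t ht).continuousWithinAt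
  have hR4 : R ^ 3 ≥ 4 * R := by nlinarith [mul_self_nonneg (R - 2)]
  have hyR : ∀ t ∈ Icc 0 T, y t ≤ R := by
    refine image_le_of_deriv_right_lt_deriv_boundary hyc
      (fun t ht => hasDerivWithinAt_Ici_of_Icc ht (hy t (Ico_subset_Icc_self ht)))
      (by rw [hy0]; exact (abs_le.1 hRy).2) (fun t => hasDerivAt_const t R) (fun t _ htR => ?_)
    have : cl (y t) = R := by simp [hcl, htR, hR0]
    rw [this]
    simp only [cubic]
    linarith [(abs_le.1 (hcos t)).2]
  have hyR' : ∀ t ∈ Icc 0 T, -y t ≤ R := by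
    refine image_le_of_deriv_right_lt_deriv_boundary hyc.neg
      (fun t ht => (hasDerivWithinAt_Ici_of_Icc ht (hy t (Ico_subset_Icc_self ht))).neg)
      (by rw [Pi.neg_apply, hy0]; linarith [(abs_le.1 hRy).1]) (fun t => hasDerivAt_const t R)
      (fun t _ htR => ?_)
    have h1 : y t = -R := by rw [← htR, Pi.neg_apply, neg_neg]
    have : cl (y t) = -R := by simp [hcl, h1, hR0]
    rw [this]
    simp only [cubic]
    linarith [(abs_le.1 (hcos t)).1]
  refine ⟨y, hy0, fun t ht => ?_⟩
  have : cl (y t) = y t := by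
    simp only [hcl]
    rw [min_eq_left (hyR t ht), max_eq_left (by linarith [hyR' t ht])]
  have h1 := hy t ht
  rwa [this] at h1

lemma integral_nat_of_periodic {a : ℝ → ℝ} (ha : Continuous a)
    (hp : Function.Periodic a 1) (n : ℕ) :
    ∫ s in (0 : ℝ)..n, a s = n * ∫ s in (0 : ℝ)..1, a s := by
  have := hp.intervalIntegral_add_zsmul_eq n 0 (fun _ _ => ha.intervalIntegrable _ _)
  simpa using this

lemma IsPeriodicSolution.periodic_deriv_cubic (hx : IsPeriodicSolution cubic h x) :
    Function.Periodic (fun t => deriv cubic (x t)) 1 := fun t => by simp only [hx.2 t]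

/-- A periodic solution with a positive Floquet exponent is not Lyapunov stable. -/
lemma IsPeriodicSolution.isUnstable (hx : IsPeriodicSolution cubic h x)
    (hl : 0 < ∫ t in (0 : ℝ)..1, deriv cubic (x t)) : IsUnstable cubic h x := by
  intro hstab
  set l := ∫ t in (0 : ℝ)..1, deriv cubic (x t) with hl_def
  obtain ⟨M, hM0, hM⟩ := exists_abs_le_of_periodic hx.continuous hx.2
  have hac := continuous_deriv_cubic hx.continuous
  obtain ⟨ε, hε0, hε1, hεl⟩ : ∃ ε : ℝ, 0 < ε ∧ ε ≤ 1 ∧ (3 * M + 1) * ε ≤ l / 2 := by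
    refine ⟨min 1 (l / 2 / (3 * M + 1)), lt_min one_pos (by positivity), min_le_left _ _, ?_⟩
    calc _ ≤ (3 * M + 1) * (l / 2 / (3 * M + 1)) := by gcongr; exact min_le_right _ _
      _ = l / 2 := by field_simp
  obtain ⟨δ, hδ, hst⟩ := hstab ε hε0
  obtain ⟨n, hn⟩ := exists_nat_gt (2 * ε / δ / (l / 2))
  have hn0 : (0 : ℝ) < n := lt_of_le_of_lt (by positivity) hn
  obtain ⟨y, hy0, hy⟩ := exists_solvesOn_Icc h (x 0 + δ / 2) hn0.le
  have hd0 : y 0 - x 0 = δ / 2 := by rw [hy0]; ring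
  have hclose := hst n y hn0 hy (by rw [hd0, abs_of_pos (by positivity)]; linarith)
  obtain ⟨m, hmc, -, hm, hexp⟩ := SolvesOn.exists_sub_eq_exp hx hn0.le hy
  have hmem : (n : ℝ) ∈ Icc (0 : ℝ) n := right_mem_Icc.2 hn0.le
  have hint : n * (l / 2) ≤ ∫ s in (0 : ℝ)..n, m s := by
    have h1 : ∫ s in (0 : ℝ)..n, (deriv cubic (x s) - l / 2) = n * (l / 2) := by
      rw [intervalIntegral.integral_sub (hac.intervalIntegrable _ _)
        (continuous_const.intervalIntegrable _ _),
        integral_nat_of_periodic hac hx.periodic_deriv_cubic,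
        intervalIntegral.integral_const, ← hl_def]
      simp only [sub_zero, smul_eq_mul]
      ring
    rw [← h1]
    refine intervalIntegral.integral_mono_on hn0.le
      ((hac.sub continuous_const).intervalIntegrable _ _) (hmc.intervalIntegrable _ _)
      (fun s hs => ?_)
    rw [hm s hs, deriv_cubic]
    simp only [divDiff]
    have h2 := abs_lt.1 (hclose s hs)
    have h3 := abs_le.1 (hM s)
    set u := y s - x s with hu
    have h4 : y s = x s + u := by rw [hu]; ring
    rw [h4]
    have h5 : 3 * x s * u ≤ 3 * M * ε := by
      have : |x s * u| ≤ M * ε := by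
        rw [abs_mul]; exact mul_le_mul (hM s) (hclose s hs).le (abs_nonneg _) hM0
      linarith [(abs_le.1 this).2]
    have h6 : u ^ 2 ≤ ε := by nlinarith
    nlinarith
  have h1 := hexp n hmem
  have h2 := (abs_lt.1 (hclose n hmem)).2
  rw [h1, hd0] at h2
  have h3 : n * (l / 2) < Real.exp (∫ s in (0 : ℝ)..n, m s) := by
    linarith [Real.add_one_le_exp (∫ s in (0 : ℝ)..n, m s)]
  have h4 : 2 * ε / δ < n * (l / 2) := by rwa [div_lt_iff₀ (by positivity)] at hn
  rw [div_lt_iff₀ hδ] at h4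
  nlinarith

/-! ### Linearized stability -/

/-- Linearized stability. With `l = ∫ f'(x) < 0` and the periodic function
`P(t) = ∫₀ᵗ f'(x) - l t`, the quantity `|y - x| e^{-P}` decreases as long as it is small. -/
lemma IsPeriodicSolution.exists_exponential_estimate (hx : IsPeriodicSolution cubic h x)
    (hl : ∫ t in (0 : ℝ)..1, deriv cubic (x t) < 0) :
    ∃ r C κ : ℝ, 0 < r ∧ 0 < C ∧ 0 < κ ∧ ∀ (T : ℝ) (y : ℝ → ℝ), 0 ≤ T →
      SolvesOn cubic h y (Icc 0 T) → |y 0 - x 0| ≤ r →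
      ∀ t ∈ Icc 0 T, |y t - x t| ≤ C * |y 0 - x 0| * Real.exp (-(κ * t)) := by
  set l := ∫ t in (0 : ℝ)..1, deriv cubic (x t) with hl_def
  have hac := continuous_deriv_cubic hx.continuous
  set P : ℝ → ℝ := fun t => (∫ s in (0 : ℝ)..t, deriv cubic (x s)) - l * t with hP
  have hPc : Continuous P := (continuous_primitive hac).sub (by fun_prop)
  have hPp : Function.Periodic P 1 := by
    set a : Circ := toCirc _ hac hx.periodic_deriv_cubic with ha
    have h1 : primFun a = P := by
      ext t
      simp [primFun, hP, ha, meanL_apply, hl_def, mul_comm]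
    rw [← h1]
    exact periodic_primFun a
  obtain ⟨K, hK0, hK⟩ := exists_abs_le_of_periodic hPc hPp
  obtain ⟨M, hM0, hM⟩ := exists_abs_le_of_periodic hx.continuous hx.2
  -- For `|y - x| ≤ r e^K` the nonlinear terms are dominated by `-l / 2`.
  set r := -l / 2 / (3 * M + 1) / Real.exp K with hr
  have hr0 : 0 < r := by
    have : 0 < -l / 2 := by linarith
    positivity
  have hrl : 3 * M * (r * Real.exp K) ≤ -l / 2 := by
    have h1 : r * Real.exp K = -l / 2 / (3 * M + 1) := by
      rw [hr]; field_simp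
    rw [h1, ← mul_div_assoc, div_le_iff₀ (by positivity)]
    nlinarith
  refine ⟨r, Real.exp K, -l / 2, hr0, Real.exp_pos _, by linarith, fun T y hT hy h0 => ?_⟩
  obtain ⟨m, hmc, -, hm, hexp⟩ := SolvesOn.exists_sub_eq_exp hx hT hy
  set z : ℝ → ℝ := fun t => |y 0 - x 0| *
    Real.exp (∫ s in (0 : ℝ)..t, (m s - deriv cubic (x s) + l)) with hz
  have hnc : Continuous fun s => m s - deriv cubic (x s) + l := by fun_prop
  have hzd : ∀ t, HasDerivAt z (z t * (m t - deriv cubic (x t) + l)) t := fun t => by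
    refine ((hasDerivAt_primitive hnc t).exp.const_mul _).congr_deriv ?_
    simp only [hz]; ring
  have hzy : ∀ t ∈ Icc 0 T, |y t - x t| = z t * Real.exp (P t) := fun t ht => by
    rw [hexp t ht, abs_mul, Real.abs_exp]
    simp only [hz, hP]
    rw [mul_assoc, ← Real.exp_add, intervalIntegral.integral_add, intervalIntegral.integral_sub,
      intervalIntegral.integral_const]
    · simp only [sub_zero, smul_eq_mul]
      congr 2
      ring
    all_goals exact Continuous.intervalIntegrable (by fun_prop) _ _
  have hz0 : ∀ t, 0 ≤ z t := fun t => by positivity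
  have hsmall : ∀ t ∈ Icc 0 T, z t ≤ r → m t - deriv cubic (x t) ≤ -l / 2 := by
    intro t ht htr
    have h1 : |y t - x t| ≤ r * Real.exp K := by
      rw [hzy t ht]
      exact mul_le_mul htr (Real.exp_le_exp.2 ((le_abs_self _).trans (hK t)))
        (Real.exp_pos _).le hr0.le
    rw [hm t ht, deriv_cubic]
    simp only [divDiff]
    have h2 : |x t * (y t - x t)| ≤ M * (r * Real.exp K) := by
      rw [abs_mul]; exact mul_le_mul (hM t) h1 (abs_nonneg _) hM0
    nlinarith [(abs_le.1 h2).1, sq_nonneg (y t - x t)]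
  have hzr : ∀ t ∈ Icc 0 T, z t ≤ r := by
    refine image_le_of_deriv_right_lt_deriv_boundary
      (fun t _ => (hzd t).continuousAt.continuousWithinAt)
      (fun t _ => (hzd t).hasDerivWithinAt) (by simpa [hz] using h0)
      (fun t => hasDerivAt_const t r) (fun t ht htr => ?_)
    have := hsmall t (Ico_subset_Icc_self ht) htr.le
    rw [htr]
    exact mul_neg_of_pos_of_neg hr0 (by linarith)
  intro t ht
  rw [hzy t ht]
  have hint : ∫ s in (0 : ℝ)..t, (m s - deriv cubic (x s) + l) ≤ -(-l / 2 * t) := by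
    have h1 := intervalIntegral.integral_mono_on (μ := MeasureTheory.volume) ht.1
      (hnc.intervalIntegrable _ _)
      (continuous_const.intervalIntegrable (u := fun _ => l / 2) _ _)
      (fun s hs => by
        have hs' : s ∈ Icc 0 T := ⟨hs.1, hs.2.trans ht.2⟩
        linarith [hsmall s hs' (hzr s hs')])
    rw [intervalIntegral.integral_const] at h1
    simp only [sub_zero, smul_eq_mul] at h1
    linarith
  calc z t * Real.exp (P t) ≤ (|y 0 - x 0| * Real.exp (-(-l / 2 * t))) * Real.exp K := by
        refine mul_le_mul ?_ (Real.exp_le_exp.2 ((le_abs_self _).trans (hK t)))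
          (Real.exp_pos _).le (by positivity)
        exact mul_le_mul_of_nonneg_left (Real.exp_le_exp.2 hint) (abs_nonneg _)
    _ = _ := by ring

/-- A periodic solution with a negative Floquet exponent is asymptotically stable. -/
lemma IsPeriodicSolution.isStable (hx : IsPeriodicSolution cubic h x)
    (hl : ∫ t in (0 : ℝ)..1, deriv cubic (x t) < 0) : IsStable cubic h x := by
  obtain ⟨r, C, κ, hr, hC, hκ, hest⟩ := hx.exists_exponential_estimate hl
  constructor
  · intro ε hε
    refine ⟨min r (ε / C), lt_min hr (by positivity), fun T y hT hy h0 t ht => ?_⟩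
    refine (hest T y hT.le hy (h0.le.trans (min_le_left _ _)) t ht).trans_lt ?_
    have h1 : Real.exp (-(κ * t)) ≤ 1 := Real.exp_le_one_iff.2 (by nlinarith [ht.1])
    have h2 := h0.trans_le (min_le_right _ _)
    rw [lt_div_iff₀ hC] at h2
    calc _ ≤ C * |y 0 - x 0| * 1 := by gcongr
      _ < ε := by linarith
  · refine ⟨r, hr, fun y hy h0 => ?_⟩
    have hbd : ∀ t, 0 ≤ t → |y t - x t| ≤ C * |y 0 - x 0| * Real.exp (-(κ * t)) := fun t ht =>
      hest t y ht (fun s hs => (hy s hs.1).mono Icc_subset_Ici_self) h0.le t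
        (right_mem_Icc.2 ht)
    refine squeeze_zero_norm' (eventually_atTop.2 ⟨0, hbd⟩) ?_
    have h1 : Tendsto (fun t => Real.exp (-(κ * t))) atTop (𝓝 0) :=
      Real.tendsto_exp_neg_atTop_nhds_zero.comp (tendsto_id.const_mul_atTop hκ)
    simpa using h1.const_mul (C * |y 0 - x 0|)

end

/-! ### The pitchfork -/

/-- Translation of periodic functions by half a period. -/
noncomputable def halfShift (y : Circ) : Circ :=
  y.comp ⟨fun x => x + ((1 / 2 : ℝ) : UnitAddCircle), by fun_prop⟩

@[simp] lemma halfShift_apply (y : Circ) (t : ℝ) :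
    halfShift y (t : UnitAddCircle) = y ((t + 1 / 2 : ℝ) : UnitAddCircle) := rfl

lemma continuous_halfShift : Continuous halfShift := ContinuousMap.continuous_precomp _

/-- A zero of a function that is strictly increasing in its first variable depends continuously on
the second variable. -/
lemma continuousWithinAt_of_strictMonoOn_zero {Q : ℝ → ℝ → ℝ} {z : ℝ → ℝ} {s : Set ℝ} {b : ℝ}
    (hmono : ∀ h ∈ s, StrictMonoOn (fun ξ => Q ξ h) (Icc 0 b))
    (hz : ∀ h ∈ s, z h ∈ Ico 0 b ∧ Q (z h) h = 0)
    (hcont : ∀ ξ ∈ Icc 0 b, ∀ h ∈ s, ContinuousAt (Q ξ) h) {h : ℝ} (hs : h ∈ s) :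
    ContinuousWithinAt z s h := by
  obtain ⟨⟨hz0, hzb⟩, hzQ⟩ := hz h hs
  refine tendsto_order.2 ⟨fun a ha => ?_, fun a ha => ?_⟩
  · rcases lt_or_ge a 0 with h0 | h0
    · filter_upwards [self_mem_nhdsWithin] with k hk using h0.trans_le (hz k hk).1.1
    · have haI : a ∈ Icc 0 b := ⟨h0, (ha.trans hzb).le⟩
      have hneg : Q a h < 0 := hzQ ▸ hmono h hs haI ⟨hz0, hzb.le⟩ ha
      filter_upwards [self_mem_nhdsWithin,
        nhdsWithin_le_nhds ((hcont a haI h hs).eventually_lt_const hneg)] with k hk hkQ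
      obtain ⟨⟨h1, h2⟩, h3⟩ := hz k hk
      by_contra! hcon
      exact absurd ((hmono k hk).monotoneOn ⟨h1, h2.le⟩ haI hcon)
        (not_le.2 (by simpa [h3] using hkQ))
  · rcases lt_or_ge b a with h0 | h0
    · filter_upwards [self_mem_nhdsWithin] with k hk using (hz k hk).1.2.trans h0
    · have haI : a ∈ Icc 0 b := ⟨hz0.trans ha.le, h0⟩
      have hpos : 0 < Q a h := hzQ ▸ hmono h hs ⟨hz0, hzb.le⟩ haI ha
      filter_upwards [self_mem_nhdsWithin,
        nhdsWithin_le_nhds ((hcont a haI h hs).eventually_const_lt hpos)] with k hk hkQ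
      obtain ⟨⟨h1, h2⟩, h3⟩ := hz k hk
      by_contra! hcon
      exact absurd ((hmono k hk).monotoneOn haI ⟨h1, h2.le⟩ hcon)
        (not_le.2 (by simpa [h3] using hkQ))

section

variable {h hc : ℝ} {x x₀ : ℝ → ℝ}

/-- A periodic solution, as a function on the circle. -/
noncomputable def IsPeriodicSolution.circ (hx : IsPeriodicSolution cubic h x) : Circ :=
  toCirc x hx.continuous hx.2

@[simp] lemma IsPeriodicSolution.circ_apply (hx : IsPeriodicSolution cubic h x) (t : ℝ) :
    hx.circ (t : UnitAddCircle) = x t := toCirc_apply _ _ _ t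

/-- A solution of the forced equation with the same weighted mean as the zero-mean solution for
another amplitude is itself an unforced solution, because it is fixed by the half-period
symmetry. -/
lemma IsForced.isZeroMeanSolution {c : ℝ} {e w : ℝ → ℝ} (he0 : ∀ t, 0 < e t)
    (he : ∀ t, e (t + 1 / 2) = e t) (hwc : Continuous w) (hw0 : ∀ t, 0 < w t)
    (hw : ∀ t, w (t + 1 / 2) = w t) (hx₀ : IsZeroMeanSolution cubic hc x₀)
    (hx : IsForced h c e x) (hint : ∫ t in (0 : ℝ)..1, w t * (x t - x₀ t) = 0) :
    c = 0 ∧ IsZeroMeanSolution cubic h x := by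
  have hx₀c := hx₀.1.continuous
  have hwp := periodic_of_add_half hw
  have h1 : ∫ t in (0 : ℝ)..1, w t * (-x (t + 1 / 2) - x₀ t) = 0 := by
    have h2 := integral_half_shift (x := fun t => w t * (x t - x₀ t)) fun t => by
      simp only [hwp t, hx.2 t, hx₀.1.2 t]
    rw [hint] at h2
    rw [← neg_eq_zero, ← intervalIntegral.integral_neg, ← h2]
    congr 1; ext t
    rw [hw, hx₀.antiperiodic]
    ring
  have hxc := hx.continuous
  have h3 : ∫ t in (0 : ℝ)..1, w t * (-x (t + 1 / 2) - x t) = 0 := by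
    have : ∀ t, w t * (-x (t + 1 / 2) - x t)
        = w t * (-x (t + 1 / 2) - x₀ t) - w t * (x t - x₀ t) := fun t => by ring
    simp only [this]
    rw [intervalIntegral.integral_sub, h1, hint, sub_zero]
    all_goals exact Continuous.intervalIntegrable (by fun_prop) _ _
  obtain ⟨hcc, hxx⟩ := hx.unique he0 hwc hw0 (hx.mirror he) h3
  have hc0 : c = 0 := by linarith
  refine ⟨hc0, ?_⟩
  subst hc0
  refine ((isPeriodicSolution_iff e).2 hx).isZeroMeanSolution_of_antiperiodic fun t => ?_
  have := congrFun hxx t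
  linarith

/-- The local branch `Y(ξ, h)` of solutions of the equation with a constant additional forcing
`c(ξ, h)` and with mean `ξ`, on a square of parameters. -/
lemma exists_constant_forcing_branch (hx₀ : IsZeroMeanSolution cubic hc x₀) :
    ∃ (Y : ℝ × ℝ → Circ) (c : ℝ × ℝ → ℝ) (r : ℝ), 0 < r ∧ Y (0, hc) = hx₀.1.circ ∧
      ∀ p : ℝ × ℝ, |p.1| < r → |p.2 - hc| < r →
        IsForced p.2 (c p) (fun _ => 1) (fun t => Y p (t : UnitAddCircle)) ∧
        ∫ t in (0 : ℝ)..1, 1 * (Y p (t : UnitAddCircle) - x₀ t) = p.1 ∧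
        ContinuousAt Y p ∧ dist (Y p) hx₀.1.circ < 1 := by
  obtain ⟨Y, c, hY, -, hY0, -, hev, -⟩ := exists_smooth_family (hc := hc) (A := 1)
    (x₀ := hx₀.1.circ) (e := 1) (w := 1) (fun _ => one_pos) (fun _ => one_pos)
    (fun t => by simpa using hx₀.1.hasDerivAt t)
  have h1 : ∀ᶠ p in 𝓝 ((0 : ℝ), hc), ContinuousAt Y p := by
    have hY1 : ContDiffAt ℝ 1 Y (0, hc) := hY.of_le (mod_cast le_top)
    filter_upwards [hY1.eventually (by simp)] with p hp
    exact hp.continuousAt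
  have h2 : ∀ᶠ p in 𝓝 ((0 : ℝ), hc), dist (Y p) hx₀.1.circ < 1 := by
    have := hY.continuousAt.eventually (Metric.ball_mem_nhds _ one_pos)
    rwa [hY0] at this
  obtain ⟨r, hr, hball⟩ := Metric.eventually_nhds_iff.1 (hev.and (h1.and h2))
  refine ⟨Y, c, r, hr, hY0, fun p hp1 hp2 => ?_⟩
  obtain ⟨⟨h3, h4⟩, h5, h6⟩ := hball (y := p)
    (by simpa [Prod.dist_eq, Real.dist_eq] using ⟨hp1, hp2⟩)
  exact ⟨⟨fun t => by simpa using h3 t, (Y p).periodic_coe⟩, by simpa using h4, h5, h6⟩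

/-- The Floquet exponent `∫ f'(y)`, written as a manifestly continuous function of `y`. -/
lemma meanL_one_sub (y : Circ) : meanL (1 - (3 : ℝ) • y ^ 2) =
    ∫ t in (0 : ℝ)..1, deriv cubic (y (t : UnitAddCircle)) := by
  simp [meanL_apply, deriv_cubic]

lemma tendstoUniformly_coe {α : Type*} {F : α → Circ} {G : Circ} {l : Filter α}
    (hF : Tendsto F l (𝓝 G)) :
    TendstoUniformly (fun a (t : ℝ) => F a (t : UnitAddCircle))
      (fun t : ℝ => G (t : UnitAddCircle)) l :=
  (ContinuousMap.tendsto_iff_tendstoUniformly.1 hF).comp fun t : ℝ => (t : UnitAddCircle)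

end

section

variable {hc : ℝ} {x₀ : ℝ → ℝ}

/-- A branch `Y(ξ, h)` as in `exists_constant_forcing_branch`. -/
structure IsBranch (hx₀ : IsZeroMeanSolution cubic hc x₀) (Y : ℝ → ℝ → Circ) (c : ℝ → ℝ → ℝ)
    (r : ℝ) : Prop where
  pos : 0 < r
  base : Y 0 hc = hx₀.1.circ
  forced : ∀ ξ h, |ξ| < r → |h - hc| < r →
    IsForced h (c ξ h) (fun _ => 1) (fun t => Y ξ h (t : UnitAddCircle))
  mean : ∀ ξ h, |ξ| < r → |h - hc| < r →
    ∫ t in (0 : ℝ)..1, 1 * (Y ξ h (t : UnitAddCircle) - x₀ t) = ξ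
  cont : ∀ ξ h, |ξ| < r → |h - hc| < r → ContinuousAt (fun p : ℝ × ℝ => Y p.1 p.2) (ξ, h)
  close : ∀ ξ h, |ξ| < r → |h - hc| < r → dist (Y ξ h) hx₀.1.circ < 1

/-- With `p = Y(ξ, h) - Y(0, h)`, the function `∫ p(t) p(t + 1/2) dt - ∫ f'(Y(0, h))`. It has the
sign of `c(ξ, h)` for `ξ > 0`, and it is strictly increasing in `ξ ≥ 0`. -/
noncomputable def branchFun (Y : ℝ → ℝ → Circ) (ξ h : ℝ) : ℝ :=
  meanL ((Y ξ h - Y 0 h) * (halfShift (Y ξ h) - halfShift (Y 0 h)))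
    - meanL (1 - (3 : ℝ) • Y 0 h ^ 2)

namespace IsBranch

variable {hx₀ : IsZeroMeanSolution cubic hc x₀} {Y : ℝ → ℝ → Circ} {c : ℝ → ℝ → ℝ} {r ξ η h : ℝ}

lemma abs_zero_lt (hB : IsBranch hx₀ Y c r) : |(0 : ℝ)| < r := by simpa using hB.pos

lemma center (hB : IsBranch hx₀ Y c r) (hh : |h - hc| < r) :
    IsZeroMeanSolution cubic h fun t => Y 0 h (t : UnitAddCircle) :=
  ((hB.forced 0 h hB.abs_zero_lt hh).isZeroMeanSolution (w := fun _ => 1) (fun _ => one_pos)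
    (fun _ => rfl) continuous_const (fun _ => one_pos) (fun _ => rfl) hx₀
    (hB.mean 0 h hB.abs_zero_lt hh)).2

lemma lt (hB : IsBranch hx₀ Y c r) (hξ : |ξ| < r) (hη : |η| < r) (hlt : ξ < η)
    (hh : |h - hc| < r) (t : ℝ) : Y ξ h (t : UnitAddCircle) < Y η h (t : UnitAddCircle) := by
  refine (hB.forced ξ h hξ hh).lt (w := fun _ => 1) (fun _ => one_pos) continuous_const
    (fun _ => one_pos) (hB.forced η h hη hh) ?_ t
  have h1 := hB.mean ξ h hξ hh
  have h2 := hB.mean η h hη hh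
  have hx₀c := hx₀.1.continuous
  have h3 := (Y ξ h).continuous_coe
  have h4 := (Y η h).continuous_coe
  have h5 : ∫ t in (0 : ℝ)..1, 1 * (Y η h (t : UnitAddCircle) - Y ξ h (t : UnitAddCircle))
      = η - ξ := by
    refine Eq.trans ?_ (congrArg₂ (· - ·) h2 h1)
    rw [← intervalIntegral.integral_sub]
    · congr 1; ext t; ring
    all_goals exact Continuous.intervalIntegrable (by fun_prop) _ _
  rw [h5]
  linarith

lemma branchFun_eq (Y : ℝ → ℝ → Circ) (ξ h : ℝ) : branchFun Y ξ h =
    (∫ t in (0 : ℝ)..1, (Y ξ h (t : UnitAddCircle) - Y 0 h (t : UnitAddCircle)) *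
      (Y ξ h ((t + 1 / 2 : ℝ) : UnitAddCircle) - Y 0 h ((t + 1 / 2 : ℝ) : UnitAddCircle)))
    - ∫ t in (0 : ℝ)..1, deriv cubic (Y 0 h (t : UnitAddCircle)) := by
  rw [branchFun, meanL_one_sub]
  rfl

lemma branchFun_zero (Y : ℝ → ℝ → Circ) (h : ℝ) : branchFun Y 0 h =
    -∫ t in (0 : ℝ)..1, deriv cubic (Y 0 h (t : UnitAddCircle)) := by
  simp [branchFun_eq]

lemma branchFun_lt (hB : IsBranch hx₀ Y c r) (h0 : 0 ≤ ξ) (hlt : ξ < η) (hη : η < r)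
    (hh : |h - hc| < r) : branchFun Y ξ h < branchFun Y η h := by
  have hξr : |ξ| < r := by rw [abs_of_nonneg h0]; linarith
  have hηr : |η| < r := by rw [abs_of_nonneg (by linarith)]; linarith
  rw [branchFun_eq, branchFun_eq]
  refine sub_lt_sub_right ?_ _
  refine integral_mul_shift_lt
    (p := fun t : ℝ => Y ξ h (t : UnitAddCircle) - Y 0 h (t : UnitAddCircle))
    (q := fun t : ℝ => Y η h (t : UnitAddCircle) - Y 0 h (t : UnitAddCircle))
    ((Y ξ h).continuous_coe.sub (Y 0 h).continuous_coe)
    ((Y η h).continuous_coe.sub (Y 0 h).continuous_coe) (fun t => ?_)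
    (fun t => sub_lt_sub_right (hB.lt hξr hηr hlt hh t) _)
  rcases h0.eq_or_lt with rfl | h0
  · simp
  · exact (sub_pos.2 (hB.lt hB.abs_zero_lt hξr h0 hh t)).le

lemma forcing_eq_zero (hB : IsBranch hx₀ Y c r) (h0 : 0 < ξ) (hξ : ξ < r) (hh : |h - hc| < r)
    (hQ : branchFun Y ξ h = 0) : c ξ h = 0 := by
  have hξr : |ξ| < r := by rw [abs_of_pos h0]; linarith
  have hlt := hB.lt hB.abs_zero_lt hξr h0 hh
  have hid := integral_deriv_cubic_eq continuous_const (fun _ => rfl) (hB.center hh)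
    (hB.forced ξ h hξr hh) hlt
  rw [branchFun_eq] at hQ
  have hI := integral_ratio_pos (e := fun _ => 1)
    (p := fun t : ℝ => Y ξ h (t : UnitAddCircle) - Y 0 h (t : UnitAddCircle)) continuous_const
    (fun _ => one_pos) ((Y ξ h).continuous_coe.sub (Y 0 h).continuous_coe)
    (fun t => sub_pos.2 (hlt t))
  refine (mul_eq_zero.1 (?_ : c ξ h * _ = 0)).resolve_right hI.ne'
  linarith

lemma continuousAt_slice (hB : IsBranch hx₀ Y c r) (hξ : |ξ| < r) (hh : |h - hc| < r) :
    ContinuousAt (fun k => Y ξ k) h :=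
  ContinuousAt.comp (g := fun p : ℝ × ℝ => Y p.1 p.2) (f := fun k => (ξ, k)) (hB.cont ξ h hξ hh)
    (by fun_prop)

lemma continuousAt_branchFun_right (hB : IsBranch hx₀ Y c r) (hξ : |ξ| < r) (hh : |h - hc| < r) :
    ContinuousAt (branchFun Y ξ) h := by
  have h1 := hB.continuousAt_slice hξ hh
  have h2 := hB.continuousAt_slice hB.abs_zero_lt hh
  have h3 : Continuous fun y : Circ => meanL (1 - (3 : ℝ) • y ^ 2) := by fun_prop
  unfold branchFun
  exact (meanL.continuous.continuousAt.comp ((h1.sub h2).mul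
    ((continuous_halfShift.continuousAt.comp h1).sub
      (continuous_halfShift.continuousAt.comp h2)))).sub
    (h3.continuousAt.comp h2)

lemma continuousAt_branchFun_left (hB : IsBranch hx₀ Y c r) (hξ : |ξ| < r) (hh : |h - hc| < r) :
    ContinuousAt (fun ξ => branchFun Y ξ h) ξ := by
  have h1 : ContinuousAt (fun ξ => Y ξ h) ξ :=
    ContinuousAt.comp (g := fun p : ℝ × ℝ => Y p.1 p.2) (f := fun k => (k, h)) (hB.cont ξ h hξ hh)
      (by fun_prop)
  unfold branchFun
  exact (meanL.continuous.continuousAt.comp ((h1.sub continuousAt_const).mul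
    ((continuous_halfShift.continuousAt.comp h1).sub continuousAt_const))).sub continuousAt_const

lemma continuousAt_exponent (hB : IsBranch hx₀ Y c r) (hh : |h - hc| < r) :
    ContinuousAt (fun h => ∫ t in (0 : ℝ)..1, deriv cubic (Y 0 h (t : UnitAddCircle))) h := by
  have := (hB.continuousAt_branchFun_right hB.abs_zero_lt hh).neg
  refine this.congr (Eventually.of_forall fun k => ?_)
  simp [branchFun_zero]

/-- The Floquet exponent of the central solution changes sign at `hc`: a negative or vanishing
exponent implies Lyapunov stability, a positive one instability. -/
lemma exists_exponent_sign (hB : IsBranch hx₀ Y c r) (hgain : IsStabilityGaining cubic hc) :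
    ∃ δ, 0 < δ ∧ δ ≤ r ∧
      (∀ h ∈ Ioo (hc - δ) hc, 0 < ∫ t in (0 : ℝ)..1, deriv cubic (Y 0 h (t : UnitAddCircle))) ∧
      (∀ h ∈ Ioo (hc - δ) hc, IsUnstable cubic h fun t => Y 0 h (t : UnitAddCircle)) ∧
      (∀ h ∈ Ioo hc (hc + δ), ∫ t in (0 : ℝ)..1, deriv cubic (Y 0 h (t : UnitAddCircle)) ≤ 0) ∧
      (∀ h ∈ Ioo hc (hc + δ), IsStable cubic h fun t => Y 0 h (t : UnitAddCircle)) := by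
  obtain ⟨l, hl, hl'⟩ := (mem_nhdsLT_iff_exists_Ioo_subset).1 hgain.1
  obtain ⟨u, hu, hu'⟩ := (mem_nhdsGT_iff_exists_Ioo_subset).1 hgain.2
  have hr := hB.pos
  refine ⟨min r (min (hc - l) (u - hc)), lt_min hr (lt_min (sub_pos.2 hl) (sub_pos.2 hu)),
    min_le_left _ _, ?_⟩
  set δ := min r (min (hc - l) (u - hc)) with hδ
  have hδr : δ ≤ r := min_le_left _ _
  have hδl : δ ≤ hc - l := (min_le_right _ _).trans (min_le_left _ _)
  have hδu : δ ≤ u - hc := (min_le_right _ _).trans (min_le_right _ _)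
  have hleft : ∀ h ∈ Ioo (hc - δ) hc, IsUnstable cubic h fun t => Y 0 h (t : UnitAddCircle) :=
    fun h hh => hl' ⟨by linarith [hh.1], hh.2⟩ _
      (hB.center (abs_lt.2 ⟨by linarith [hh.1], by linarith [hh.2]⟩))
  have hright : ∀ h ∈ Ioo hc (hc + δ), IsStable cubic h fun t => Y 0 h (t : UnitAddCircle) :=
    fun h hh => hu' ⟨hh.1, by linarith [hh.2]⟩ _
      (hB.center (abs_lt.2 ⟨by linarith [hh.1], by linarith [hh.2]⟩))
  refine ⟨fun h hh => ?_, hleft, fun h hh => ?_, hright⟩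
  · by_contra! hcon
    exact hleft h hh ((hB.center (abs_lt.2
      ⟨by linarith [hh.1], by linarith [hh.2]⟩)).isLyapunovStable hcon)
  · by_contra! hcon
    exact (hB.center (abs_lt.2
      ⟨by linarith [hh.1], by linarith [hh.2]⟩)).1.isUnstable hcon (hright h hh).1

lemma exponent_eq_zero (hB : IsBranch hx₀ Y c r) (hgain : IsStabilityGaining cubic hc) :
    ∫ t in (0 : ℝ)..1, deriv cubic (Y 0 hc (t : UnitAddCircle)) = 0 := by
  obtain ⟨δ, hδ, -, hneg, -, hpos, -⟩ := hB.exists_exponent_sign hgain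
  have hc' := hB.continuousAt_exponent (h := hc) (by simpa using hB.pos)
  refine le_antisymm ?_ ?_
  · refine le_of_tendsto (x := 𝓝[>] hc) (hc'.tendsto.mono_left nhdsWithin_le_nhds) ?_
    filter_upwards [Ioo_mem_nhdsGT (show hc < hc + δ by linarith)] with h hh using hpos h hh
  · refine ge_of_tendsto (x := 𝓝[<] hc) (hc'.tendsto.mono_left nhdsWithin_le_nhds) ?_
    filter_upwards [Ioo_mem_nhdsLT (show hc - δ < hc by linarith)] with h hh using (hneg h hh).le

end IsBranch

lemma exists_isBranch (hx₀ : IsZeroMeanSolution cubic hc x₀) :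
    ∃ (Y : ℝ → ℝ → Circ) (c : ℝ → ℝ → ℝ) (r : ℝ), IsBranch hx₀ Y c r := by
  obtain ⟨Y, c, r, hr, hY0, hY⟩ := exists_constant_forcing_branch hx₀
  exact ⟨fun ξ h => Y (ξ, h), fun ξ h => c (ξ, h), r, hr, hY0,
    fun ξ h h1 h2 => (hY (ξ, h) h1 h2).1, fun ξ h h1 h2 => (hY (ξ, h) h1 h2).2.1,
    fun ξ h h1 h2 => (hY (ξ, h) h1 h2).2.2.1, fun ξ h h1 h2 => (hY (ξ, h) h1 h2).2.2.2⟩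

/-- At the bifurcation point the Floquet exponent vanishes. -/
theorem integral_deriv_cubic_eq_zero (hx₀ : IsZeroMeanSolution cubic hc x₀)
    (hgain : IsStabilityGaining cubic hc) : ∫ t in (0 : ℝ)..1, deriv cubic (x₀ t) = 0 := by
  obtain ⟨Y, c, r, hB⟩ := exists_isBranch hx₀
  have := hB.exponent_eq_zero hgain
  rw [hB.base] at this
  simpa using this

end

section

variable {hc : ℝ} {x₀ : ℝ → ℝ}

namespace IsBranch

variable {hx₀ : IsZeroMeanSolution cubic hc x₀} {Y : ℝ → ℝ → Circ} {c : ℝ → ℝ → ℝ} {r : ℝ}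

/-- The parameter `z(h)` of the solution above the central one. -/
lemma exists_upper_parameter (hB : IsBranch hx₀ Y c r) (hgain : IsStabilityGaining cubic hc)
    {δ : ℝ} (hδ : 0 < δ) (hδr : δ ≤ r) (hexp : ∀ h ∈ Ioo (hc - δ) hc,
      0 < ∫ t in (0 : ℝ)..1, deriv cubic (Y 0 h (t : UnitAddCircle))) :
    ∃ (z : ℝ → ℝ) (δ' : ℝ), 0 < δ' ∧ δ' ≤ δ ∧ z hc = 0 ∧
      (∀ h ∈ Ioo (hc - δ') hc, 0 < z h) ∧
      ∀ h ∈ Ioc (hc - δ') hc, 0 ≤ z h ∧ z h < r ∧ branchFun Y (z h) h = 0 ∧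
        ContinuousWithinAt z (Iic hc) h := by
  have hr := hB.pos
  have hhc : |hc - hc| < r := by simpa using hr
  have h0 : branchFun Y 0 hc = 0 := by
    rw [branchFun_zero, hB.exponent_eq_zero hgain, neg_zero]
  have hb : |r / 2| < r := by rw [abs_of_pos (by linarith)]; linarith
  have hQb : 0 < branchFun Y (r / 2) hc :=
    h0 ▸ hB.branchFun_lt le_rfl (by linarith) (by linarith) hhc
  obtain ⟨ρ, hρ, hρQ⟩ := Metric.eventually_nhds_iff.1
    ((hB.continuousAt_branchFun_right hb hhc).eventually_const_lt hQb)
  set δ' := min δ ρ with hδ'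
  have hδ'0 : 0 < δ' := lt_min hδ hρ
  have hδ'δ : δ' ≤ δ := min_le_left _ _
  have hδ'ρ : δ' ≤ ρ := min_le_right _ _
  have habs : ∀ h ∈ Ioc (hc - δ') hc, |h - hc| < r := fun h hh =>
    abs_lt.2 ⟨by linarith [hh.1], by linarith [hh.2]⟩
  have hξ : ∀ ξ ∈ Icc 0 (r / 2), |ξ| < r := fun ξ hξ => by
    rw [abs_of_nonneg hξ.1]; linarith [hξ.2]
  have hQ0 : ∀ h ∈ Ioc (hc - δ') hc, branchFun Y 0 h ≤ 0 := by
    intro h hh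
    rcases hh.2.eq_or_lt with rfl | hlt
    · exact h0.le
    · rw [branchFun_zero]
      linarith [hexp h ⟨by linarith [hh.1], hlt⟩]
  have hmono : ∀ h ∈ Ioc (hc - δ') hc, StrictMonoOn (fun ξ => branchFun Y ξ h) (Icc 0 (r / 2)) :=
    fun h hh ξ hξ η hη hlt => hB.branchFun_lt hξ.1 hlt (by linarith [hη.2]) (habs h hh)
  have hex : ∀ h, ∃ z, h ∈ Ioc (hc - δ') hc → z ∈ Ico 0 (r / 2) ∧ branchFun Y z h = 0 := by
    intro h
    by_cases hh : h ∈ Ioc (hc - δ') hc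
    · have hpos : 0 < branchFun Y (r / 2) h := hρQ (by
        rw [Real.dist_eq, abs_lt]; constructor <;> linarith [hh.1, hh.2])
      obtain ⟨z, hz, hzQ⟩ := intermediate_value_Icc (by linarith : (0 : ℝ) ≤ r / 2)
        (fun ξ hξI => (hB.continuousAt_branchFun_left (hξ ξ hξI)
          (habs h hh)).continuousWithinAt) ⟨hQ0 h hh, hpos.le⟩
      refine ⟨z, fun _ => ⟨⟨hz.1, lt_of_le_of_ne hz.2 ?_⟩, hzQ⟩⟩
      rintro rfl
      exact hpos.ne' hzQ
    · exact ⟨0, fun h' => absurd h' hh⟩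
  choose z hz using hex
  have hcmem : hc ∈ Ioc (hc - δ') hc := ⟨by linarith, le_rfl⟩
  refine ⟨z, δ', hδ'0, hδ'δ, ?_, fun h hh => ?_, fun h hh => ?_⟩
  · have := hz hc hcmem
    exact (hmono hc hcmem).injOn ⟨this.1.1, this.1.2.le⟩ ⟨le_rfl, by linarith⟩
      (by simp only [this.2, h0])
  · obtain ⟨h1, h2⟩ := hz h ⟨hh.1, hh.2.le⟩
    refine lt_of_le_of_ne h1.1 fun heq => ?_
    rw [← heq, branchFun_zero] at h2
    linarith [hexp h ⟨by linarith [hh.1], hh.2⟩]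
  · obtain ⟨h1, h2⟩ := hz h hh
    refine ⟨h1.1, by linarith [h1.2], h2, ?_⟩
    have := continuousWithinAt_of_strictMonoOn_zero hmono hz
      (fun ξ hξI k hk => hB.continuousAt_branchFun_right (hξ ξ hξI) (habs k hk)) hh
    refine this.mono_of_mem_nhdsWithin ?_
    rw [← Ioi_inter_Iic]
    exact inter_mem (mem_nhdsWithin_of_mem_nhds (Ioi_mem_nhds hh.1)) self_mem_nhdsWithin

end IsBranch

/-- The outer solutions are `Y(z(h), h)`, with `z(h)` the zero of `branchFun Y · h`, and its mirror
image. With the central solution they are all the periodic solutions, near `x₀` or not; closeness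
to `x₀` only has to be verified for these three. -/
theorem isSubcriticalPitchfork (hx₀ : IsZeroMeanSolution cubic hc x₀)
    (hgain : IsStabilityGaining cubic hc) : IsSubcriticalPitchfork cubic hc x₀ := by
  obtain ⟨Y, c, r, hB⟩ := exists_isBranch hx₀
  obtain ⟨δ₁, hδ₁, hδ₁r, hexp, hunst, hexp', hst⟩ := hB.exists_exponent_sign hgain
  obtain ⟨z, δ, hδ, hδδ₁, hzc, hzpos, hz⟩ := hB.exists_upper_parameter hgain hδ₁ hδ₁r hexp
  have hr := hB.pos
  set xs : ℝ → ℝ → ℝ := fun h t => Y 0 h (t : UnitAddCircle) with hxs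
  set xp : ℝ → ℝ → ℝ := fun h t => Y (z h) h (t : UnitAddCircle) with hxp
  set xm : ℝ → ℝ → ℝ := fun h t => -xp h (t + 1 / 2) with hxm
  have habs : ∀ h ∈ Ioo (hc - δ) (hc + δ), |h - hc| < r := fun h hh =>
    abs_lt.2 ⟨by linarith [hh.1], by linarith [hh.2]⟩
  have hzr : ∀ h ∈ Ioc (hc - δ) hc, |z h| < r := fun h hh => by
    rw [abs_of_nonneg (hz h hh).1]; exact (hz h hh).2.1
  have hcen : ∀ h ∈ Ioo (hc - δ) (hc + δ), IsZeroMeanSolution cubic h (xs h) := fun h hh =>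
    hB.center (habs h hh)
  have hclose : ∀ ξ h, |ξ| < r → |h - hc| < r →
      ∀ t : ℝ, |Y ξ h (t : UnitAddCircle) - x₀ t| < 1 := by
    intro ξ h hξ hh t
    have := (ContinuousMap.dist_apply_le_dist (t : UnitAddCircle)).trans_lt (hB.close ξ h hξ hh)
    simpa [Real.dist_eq] using this
  have hxphc : xp hc = x₀ := by
    ext t; simp [hxp, hzc, hB.base]
  have hIoc : ∀ h ∈ Ioc (hc - δ) hc, h ∈ Ioo (hc - δ) (hc + δ) := fun h hh =>
    ⟨hh.1, by linarith [hh.2]⟩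
  have hup : ∀ h ∈ Ioo (hc - δ) hc, IsPeriodicSolution cubic h (xp h) ∧ ∀ t, xs h t < xp h t := by
    intro h hh
    have hh' : h ∈ Ioc (hc - δ) hc := ⟨hh.1, hh.2.le⟩
    have hha := habs h (hIoc h hh')
    obtain ⟨-, h2, h3, -⟩ := hz h hh'
    have h4 := hB.forcing_eq_zero (hzpos h hh) h2 hha h3
    refine ⟨(isPeriodicSolution_iff fun _ => 1).2 ?_,
      hB.lt hB.abs_zero_lt (hzr h hh') (hzpos h hh) hha⟩
    rw [← h4]
    exact hB.forced _ _ (hzr h hh') hha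
  have hcontp : ∀ h ∈ Ioc (hc - δ) hc, TendstoUniformly xp (xp h) (𝓝[Iic hc] h) := by
    intro h hh
    refine tendstoUniformly_coe (F := fun k => Y (z k) k) ?_
    have h1 := (hB.cont (z h) h (hzr h hh) (habs h (hIoc h hh))).tendsto
    exact h1.comp (((hz h hh).2.2.2.tendsto).prodMk_nhds
      (tendsto_id.mono_left nhdsWithin_le_nhds))
  refine ⟨xs, xp, xm, 1, δ, one_pos, hδ, ?_, hxphc, ?_, ?_, ?_, ?_, ?_, ?_⟩
  · ext t; simp [hxs, hB.base]
  · ext t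
    simp only [hxm, hxphc]
    rw [hx₀.antiperiodic, neg_neg]
  · exact fun h hh => ⟨hcen h hh, tendstoUniformly_coe (F := fun k => Y 0 k)
      (hB.continuousAt_slice hB.abs_zero_lt (habs h hh))⟩
  · refine fun h hh => ⟨hcontp h hh, ?_⟩
    have h1 := (hcontp h hh).comp fun t : ℝ => t + 1 / 2
    rw [Metric.tendstoUniformly_iff] at h1 ⊢
    intro ε hε
    filter_upwards [h1 ε hε] with k hk t
    simpa [hxm, dist_neg_neg] using hk t
  · intro h hh
    have hhc' : h ∈ Ioc (hc - δ) hc := ⟨hh.1, hh.2.le⟩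
    have hhI := hIoc h hhc'
    obtain ⟨hp, hlt⟩ := hup h hh
    have hs := hcen h hhI
    have hm : IsPeriodicSolution cubic h (xm h) := hp.mirror
    have hlt' : ∀ t, xm h t < xs h t := fun t => by
      have := hlt (t + 1 / 2)
      rw [hs.antiperiodic] at this
      simp only [hxm]
      linarith
    have hpneg := integral_deriv_cubic_neg_of_largest hp hm hs.1 hlt' hlt
    have hmneg : ∫ t in (0 : ℝ)..1, deriv cubic (xm h t) < 0 := by
      have h1 := integral_half_shift hp.periodic_deriv_cubic
      rw [← h1] at hpneg
      simpa only [deriv_cubic, hxm, neg_sq] using hpneg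
    refine ⟨?_, fun t => ⟨hlt' t, hlt t⟩, fun t => rfl, hunst h ⟨by linarith [hh.1], hh.2⟩,
      hp.isStable hpneg, hm.isStable hmneg⟩
    ext x
    simp only [nearbySolutions, mem_ofPred_eq, mem_insert_iff, mem_singleton_iff]
    constructor
    · rintro ⟨hx, -⟩
      rcases hs.1.eq_or_lt_or_lt hx with h1 | h1 | h1
      · exact .inr (.inl h1.symm)
      · exact .inr (.inr (hs.eq_of_lt_of_lt hx hp h1 hlt))
      · left
        have h2 := hs.eq_of_lt_of_lt hx.mirror hp (fun t => by
          have := h1 (t + 1 / 2)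
          rw [hs.antiperiodic] at this
          linarith) hlt
        ext t
        simp only [hxm, ← h2]
        rw [show t + 1 / 2 + 1 / 2 = t + 1 by ring, hx.2, neg_neg]
    · have hpc : ∀ t, |xp h t - x₀ t| < 1 := hclose _ _ (hzr h hhc') (habs h hhI)
      rintro (rfl | rfl | rfl)
      · refine ⟨hm, fun t => ?_⟩
        have h1 := hpc (t + 1 / 2)
        rw [hx₀.antiperiodic, ← abs_neg] at h1
        simp only [hxm]
        convert h1 using 2
        ring
      · exact ⟨hs.1, hclose _ _ hB.abs_zero_lt (habs h hhI)⟩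
      · exact ⟨hp, hpc⟩
  · intro h hh
    have hhI : h ∈ Ioo (hc - δ) (hc + δ) := ⟨by linarith [hh.1], hh.2⟩
    have hs := hcen h hhI
    have hl : ∫ t in (0 : ℝ)..1, deriv cubic (xs h t) ≤ 0 := by
      rcases hh.1.eq_or_lt with rfl | hlt
      · exact (hB.exponent_eq_zero hgain).le
      · exact hexp' h ⟨hlt, by linarith [hh.2]⟩
    ext x
    simp only [nearbySolutions, mem_ofPred_eq, mem_singleton_iff]
    constructor
    · rintro ⟨hx, -⟩
      exact hs.eq_of_integral_nonpos hl hx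
    · rintro rfl
      exact ⟨hs.1, hclose _ _ hB.abs_zero_lt (habs h hhI)⟩
  · exact fun h hh => hst h ⟨hh.1, by linarith [hh.2]⟩

end

/-! ### Third derivatives from one-sided asymptotics -/

lemma eq_zero_of_tendsto_div_pow {F : ℝ → ℝ} {l : ℝ} {k : ℕ} (hF : ContinuousAt F 0)
    (hl : Tendsto (fun x => F x / x ^ (k + 1)) (𝓝[>] 0) (𝓝 l)) : F 0 = 0 := by
  have h1 : Tendsto (fun x : ℝ => x ^ (k + 1)) (𝓝[>] 0) (𝓝 0) := by
    have : ContinuousAt (fun x : ℝ => x ^ (k + 1)) 0 := by fun_prop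
    simpa using this.tendsto.mono_left (nhdsWithin_le_nhds (s := Ioi 0))
  have h2 := hl.mul h1
  rw [mul_zero] at h2
  refine tendsto_nhds_unique (hF.tendsto.mono_left nhdsWithin_le_nhds) (h2.congr' ?_)
  filter_upwards [self_mem_nhdsWithin] with x hx
  exact div_mul_cancel₀ _ (pow_ne_zero _ (mem_Ioi.1 hx).ne')

/-- In Taylor's formula, the coefficients of order at most two are forced to vanish one by one. -/
lemma iteratedDeriv_three_eq_of_tendsto {f : ℝ → ℝ} {l : ℝ} (hf : ContDiffAt ℝ 3 f 0)
    (hl : Tendsto (fun ξ => f ξ / ξ ^ 3) (𝓝[>] 0) (𝓝 l)) : iteratedDeriv 3 f 0 = 6 * l := by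
  obtain ⟨u, hu, hfu⟩ := hf.contDiffOn (m := 3) le_rfl (by simp)
  obtain ⟨ρ, hρ, hρu⟩ := Metric.mem_nhds_iff.1 hu
  have hfs : ContDiffOn ℝ 3 f (Metric.ball 0 ρ) := hfu.mono hρu
  have h0s : (0 : ℝ) ∈ Metric.ball (0 : ℝ) ρ := Metric.mem_ball_self hρ
  have hT := Real.taylor_tendsto (n := 3) (convex_ball (0 : ℝ) ρ) h0s hfs
  rw [Metric.isOpen_ball.nhdsWithin_eq h0s] at hT
  obtain ⟨a, ha⟩ : ∃ a : ℕ → ℝ, ∀ k, a k = iteratedDerivWithin k f (Metric.ball 0 ρ) 0 :=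
    ⟨_, fun _ => rfl⟩
  have ha3 : iteratedDeriv 3 f 0 = a 3 := by
    rw [ha, iteratedDerivWithin_of_isOpen Metric.isOpen_ball h0s]
  have hTe : ∀ x, taylorWithinEval f 3 (Metric.ball 0 ρ) 0 x
      = a 0 + a 1 * x + a 2 / 2 * x ^ 2 + a 3 / 6 * x ^ 3 := fun x => by
    rw [taylor_within_apply]
    simp only [← ha, Finset.sum_range_succ, Finset.sum_range_zero, Nat.factorial, smul_eq_mul]
    push_cast
    ring
  simp only [hTe, sub_zero] at hT
  have hq : Tendsto (fun x => (a 0 + a 1 * x + a 2 / 2 * x ^ 2 + a 3 / 6 * x ^ 3) / x ^ 3)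
      (𝓝[>] 0) (𝓝 l) := by
    have := hl.sub (hT.mono_left nhdsWithin_le_nhds)
    rw [sub_zero] at this
    refine this.congr fun x => ?_
    ring
  have h0 : a 0 = 0 := by
    simpa using eq_zero_of_tendsto_div_pow
      (F := fun x => a 0 + a 1 * x + a 2 / 2 * x ^ 2 + a 3 / 6 * x ^ 3) (by fun_prop) hq
  have h1 : a 1 = 0 := by
    suffices h : Tendsto (fun x => (a 1 + a 2 / 2 * x + a 3 / 6 * x ^ 2) / x ^ (1 + 1)) (𝓝[>] 0) (𝓝 l) by
      simpa using eq_zero_of_tendsto_div_pow (F := fun x => a 1 + a 2 / 2 * x + a 3 / 6 * x ^ 2) (by fun_prop) h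
    refine hq.congr' ?_
    filter_upwards [self_mem_nhdsWithin] with x hx
    have := (mem_Ioi.1 hx).ne'
    rw [h0]; field_simp; ring
  have h2 : a 2 = 0 := by
    suffices h : Tendsto (fun x => (a 2 / 2 + a 3 / 6 * x) / x ^ (0 + 1)) (𝓝[>] 0) (𝓝 l) by
      simpa using eq_zero_of_tendsto_div_pow (F := fun x => a 2 / 2 + a 3 / 6 * x) (by fun_prop) h
    refine hq.congr' ?_
    filter_upwards [self_mem_nhdsWithin] with x hx
    have := (mem_Ioi.1 hx).ne'
    rw [h0, h1]; field_simp; ring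
  have h3 : l = a 3 / 6 := by
    refine tendsto_nhds_unique (hq.congr' ?_) tendsto_const_nhds
    filter_upwards [self_mem_nhdsWithin] with x hx
    have := (mem_Ioi.1 hx).ne'
    rw [h0, h1, h2]; field_simp; ring
  rw [ha3, h3]
  ring

/-! ### Kernel and cokernel of the linearization -/

section

variable {hc : ℝ} {x₀ : ℝ → ℝ}

lemma ker_pos (x₀ : ℝ → ℝ) (t : ℝ) : 0 < ker cubic x₀ t := Real.exp_pos _

lemma coker_pos (x₀ : ℝ → ℝ) (t : ℝ) : 0 < coker cubic x₀ t := Real.exp_pos _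

lemma coker_eq_inv (x₀ : ℝ → ℝ) (t : ℝ) : coker cubic x₀ t = (ker cubic x₀ t)⁻¹ :=
  Real.exp_neg _

lemma hasDerivAt_ker (hx₀ : Continuous x₀) (t : ℝ) :
    HasDerivAt (ker cubic x₀) (deriv cubic (x₀ t) * ker cubic x₀ t) t := by
  refine (hasDerivAt_primitive (continuous_deriv_cubic hx₀) t).exp.congr_deriv ?_
  rw [mul_comm]; rfl

lemma continuous_ker (hx₀ : Continuous x₀) : Continuous (ker cubic x₀) :=
  continuous_iff_continuousAt.2 fun t => (hasDerivAt_ker hx₀ t).continuousAt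

lemma continuous_coker (hx₀ : Continuous x₀) : Continuous (coker cubic x₀) := by
  have : coker cubic x₀ = fun t => (ker cubic x₀ t)⁻¹ := funext (coker_eq_inv x₀)
  rw [this]
  exact (continuous_ker hx₀).inv₀ fun t => (ker_pos x₀ t).ne'

section critical

variable (hx₀ : IsZeroMeanSolution cubic hc x₀)
  (hl : ∫ t in (0 : ℝ)..1, deriv cubic (x₀ t) = 0)

lemma ker_add_half (hx₀ : IsZeroMeanSolution cubic hc x₀)
    (hl : ∫ t in (0 : ℝ)..1, deriv cubic (x₀ t) = 0) (t : ℝ) :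
    ker cubic x₀ (t + 1 / 2) = ker cubic x₀ t := by
  have hac := continuous_deriv_cubic hx₀.1.continuous
  unfold ker
  rw [← intervalIntegral.integral_add_adjacent_intervals (hac.intervalIntegrable 0 t)
    (hac.intervalIntegrable t (t + 1 / 2)), hx₀.integral_half, hl, zero_div, add_zero]

lemma coker_add_half (hx₀ : IsZeroMeanSolution cubic hc x₀)
    (hl : ∫ t in (0 : ℝ)..1, deriv cubic (x₀ t) = 0) (t : ℝ) :
    coker cubic x₀ (t + 1 / 2) = coker cubic x₀ t := by
  rw [coker_eq_inv, coker_eq_inv, ker_add_half hx₀ hl]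

/-- The kernel generator `v` on the circle. -/
noncomputable def kerC (hx₀ : IsZeroMeanSolution cubic hc x₀)
    (hl : ∫ t in (0 : ℝ)..1, deriv cubic (x₀ t) = 0) : Circ :=
  toCirc (ker cubic x₀) (continuous_ker hx₀.1.continuous)
    (periodic_of_add_half (ker_add_half hx₀ hl))

/-- The cokernel generator `v*` on the circle. -/
noncomputable def cokerC (hx₀ : IsZeroMeanSolution cubic hc x₀)
    (hl : ∫ t in (0 : ℝ)..1, deriv cubic (x₀ t) = 0) : Circ :=
  toCirc (coker cubic x₀) (continuous_coker hx₀.1.continuous)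
    (periodic_of_add_half (coker_add_half hx₀ hl))

@[simp] lemma kerC_apply (t : ℝ) : kerC hx₀ hl (t : UnitAddCircle) = ker cubic x₀ t :=
  toCirc_apply _ _ _ t

@[simp] lemma cokerC_apply (t : ℝ) : cokerC hx₀ hl (t : UnitAddCircle) = coker cubic x₀ t :=
  toCirc_apply _ _ _ t

lemma kerC_pos (x : UnitAddCircle) : 0 < kerC hx₀ hl x := by
  obtain ⟨t, rfl⟩ := QuotientAddGroup.mk_surjective x
  exact (kerC_apply hx₀ hl t).symm ▸ ker_pos x₀ t

lemma cokerC_pos (x : UnitAddCircle) : 0 < cokerC hx₀ hl x := by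
  obtain ⟨t, rfl⟩ := QuotientAddGroup.mk_surjective x
  exact (cokerC_apply hx₀ hl t).symm ▸ coker_pos x₀ t

lemma borderedL_kerC : borderedL hx₀.1.circ (cokerC hx₀ hl) (kerC hx₀ hl) (kerC hx₀ hl, 0)
    = (0, ip (ker cubic x₀) (ker cubic x₀)) := by
  rw [borderedL_apply]
  refine Prod.ext ((odeL_eq_zero_iff _ _).2 fun t => ?_) ?_
  · have := hasDerivAt_ker hx₀.1.continuous t
    rw [deriv_cubic] at this
    simpa using! this
  · simp [meanL_apply, ip]

/-! ### The range equation -/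

/-- A solution `w` of the range equation makes `x₀ + ξ v + w` a solution of the equation with
forcing `κ v*`, where `κ` is the coordinate of the residual along `v*`. -/
lemma SolvesRangeEq.exists_isForced (hx₀ : IsZeroMeanSolution cubic hc x₀)
    (hl : ∫ t in (0 : ℝ)..1, deriv cubic (x₀ t) = 0) {ε ξ h : ℝ} {w : ℝ → ℝ}
    (hw : SolvesRangeEq cubic x₀ ε ξ h w) :
    ∃ κ, IsForced h κ (coker cubic x₀) (fun s => x₀ s + ξ * ker cubic x₀ s + w s) ∧
      (∫ t in (0 : ℝ)..1, ker cubic x₀ t * ((x₀ t + ξ * ker cubic x₀ t + w t) - x₀ t)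
        = ip (ker cubic x₀) (ker cubic x₀) * ξ) ∧
      ip (coker cubic x₀) (Phi cubic h (fun s => x₀ s + ξ * ker cubic x₀ s + w s))
        = κ * ip (coker cubic x₀) (coker cubic x₀) := by
  obtain ⟨hw1, hwp, hwv, -, hE⟩ := hw
  have hvc := continuous_ker hx₀.1.continuous
  have hwc := hw1.continuous
  have hBpos : 0 < ip (coker cubic x₀) (coker cubic x₀) :=
    integral_mul_pos (continuous_coker hx₀.1.continuous) (coker_pos x₀)
      (continuous_coker hx₀.1.continuous) (coker_pos x₀)
  refine ⟨ip (coker cubic x₀) (Phi cubic h (fun s => x₀ s + ξ * ker cubic x₀ s + w s)) /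
    ip (coker cubic x₀) (coker cubic x₀), ⟨fun t => ?_, fun t => ?_⟩, ?_, ?_⟩
  · have hd : DifferentiableAt ℝ (fun s => x₀ s + ξ * ker cubic x₀ s + w s) t :=
      (((hx₀.1.hasDerivAt t).differentiableAt).add
        ((hasDerivAt_ker hx₀.1.continuous t).differentiableAt.const_mul ξ)).add
        (hw1.differentiable one_ne_zero t)
    refine hd.hasDerivAt.congr_deriv ?_
    have := hE t
    simp only [projRange] at this
    rw [Phi] at this
    linarith
  · simp only [hx₀.1.2 t, hwp t, periodic_of_add_half (ker_add_half hx₀ hl) t]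
  · have : ∀ t, ker cubic x₀ t * ((x₀ t + ξ * ker cubic x₀ t + w t) - x₀ t) =
        ξ * (ker cubic x₀ t * ker cubic x₀ t) + ker cubic x₀ t * w t := fun t => by ring
    simp only [this]
    rw [intervalIntegral.integral_add (Continuous.intervalIntegrable (by fun_prop) _ _)
      (Continuous.intervalIntegrable (by fun_prop) _ _), intervalIntegral.integral_const_mul]
    simp only [ip] at hwv ⊢
    rw [hwv]
    ring
  · rw [div_mul_cancel₀ _ hBpos.ne']

/-- Conversely, a solution `y` of the equation with forcing `κ v*` yields the solution
`y - x₀ - ξ v` of the range equation, where `ξ` is its coordinate along `v`. -/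
lemma IsForced.solvesRangeEq (hx₀ : IsZeroMeanSolution cubic hc x₀)
    (hl : ∫ t in (0 : ℝ)..1, deriv cubic (x₀ t) = 0) {ε ξ h κ : ℝ} {y : ℝ → ℝ}
    (hy : IsForced h κ (coker cubic x₀) y)
    (hint : ∫ t in (0 : ℝ)..1, ker cubic x₀ t * (y t - x₀ t)
      = ip (ker cubic x₀) (ker cubic x₀) * ξ)
    (hε : ∀ t, |y t - x₀ t - ξ * ker cubic x₀ t| < ε)
    (hε' : ∀ t, |(cubic (y t) + h * Real.cos (2 * Real.pi * t) + κ * coker cubic x₀ t)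
      - (cubic (x₀ t) + hc * Real.cos (2 * Real.pi * t))
      - ξ * (deriv cubic (x₀ t) * ker cubic x₀ t)| < ε) :
    SolvesRangeEq cubic x₀ ε ξ h (fun t => y t - x₀ t - ξ * ker cubic x₀ t) := by
  have hx₀c := hx₀.1.continuous
  have hvc := continuous_ker hx₀c
  have hcc := continuous_coker hx₀c
  have hac := continuous_deriv_cubic hx₀c
  have hyc := hy.continuous
  have hd : ∀ t, HasDerivAt (fun t => y t - x₀ t - ξ * ker cubic x₀ t) _ t := fun t =>
    ((hy.1 t).sub (hx₀.1.hasDerivAt t)).sub ((hasDerivAt_ker hx₀c t).const_mul ξ)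
  have hsum : (fun s => x₀ s + ξ * ker cubic x₀ s + (y s - x₀ s - ξ * ker cubic x₀ s)) = y := by
    ext s; ring
  have hPhi : Phi cubic h y = fun t => κ * coker cubic x₀ t := by
    ext t
    rw [Phi, (hy.1 t).deriv]
    ring
  have hBpos : 0 < ip (coker cubic x₀) (coker cubic x₀) :=
    integral_mul_pos hcc (coker_pos x₀) hcc (coker_pos x₀)
  refine ⟨contDiff_one_iff_deriv.2 ⟨fun t => (hd t).differentiableAt, ?_⟩, fun t => ?_, ?_,
    fun t => ⟨hε t, ?_⟩, fun t => ?_⟩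
  · rw [show deriv (fun t => y t - x₀ t - ξ * ker cubic x₀ t) = _ from funext fun t => (hd t).deriv]
    simp only [cubic]
    fun_prop
  · simp only [hx₀.1.2 t, hy.2 t, periodic_of_add_half (ker_add_half hx₀ hl) t]
  · have : ∀ t, ker cubic x₀ t * (y t - x₀ t - ξ * ker cubic x₀ t) =
        ker cubic x₀ t * (y t - x₀ t) - ξ * (ker cubic x₀ t * ker cubic x₀ t) := fun t => by ring
    simp only [ip, this]
    rw [intervalIntegral.integral_sub (Continuous.intervalIntegrable (by fun_prop) _ _)
      (Continuous.intervalIntegrable (by fun_prop) _ _), intervalIntegral.integral_const_mul, hint]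
    simp only [ip]
    ring
  · rw [(hd t).deriv]
    exact hε' t
  · rw [hsum, hPhi, projRange]
    have : ip (coker cubic x₀) (fun t => κ * coker cubic x₀ t)
        = κ * ip (coker cubic x₀) (coker cubic x₀) := by
      simp only [ip]
      rw [← intervalIntegral.integral_const_mul]
      congr 1; ext t; ring
    rw [this, mul_div_assoc, div_self hBpos.ne']
    ring

/-! ### The reduced function -/

/-- The family of solutions of the bordered problem with `e = v*` and `w = v`. Its derivative in
the direction `ξ` is `v`, because `(v, 0)` solves the linearized bordered problem. -/
lemma exists_reduction_family :
    ∃ (Y : ℝ × ℝ → Circ) (c : ℝ × ℝ → ℝ), ContDiffAt ℝ ∞ Y (0, hc) ∧ ContDiffAt ℝ ∞ c (0, hc) ∧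
      Y (0, hc) = hx₀.1.circ ∧ c (0, hc) = 0 ∧
      (∀ᶠ p in 𝓝 ((0 : ℝ), hc),
        IsForced p.2 (c p) (coker cubic x₀) (fun t => Y p (t : UnitAddCircle)) ∧
        ∫ t in (0 : ℝ)..1, ker cubic x₀ t * (Y p (t : UnitAddCircle) - x₀ t)
          = ip (ker cubic x₀) (ker cubic x₀) * p.1) ∧
      HasDerivAt (fun ξ => Y (ξ, hc)) (kerC hx₀ hl) 0 := by
  obtain ⟨Y, c, hY, hcd, hY0, hc0, hev, η, κ, hη, hL⟩ := exists_smooth_family (hc := hc)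
    (A := ip (ker cubic x₀) (ker cubic x₀)) (x₀ := hx₀.1.circ) (cokerC_pos hx₀ hl)
    (kerC_pos hx₀ hl) (fun t => by simpa using hx₀.1.hasDerivAt t)
  refine ⟨Y, c, hY, hcd, hY0, hc0, ?_, ?_⟩
  · filter_upwards [hev] with p hp
    exact ⟨⟨fun t => by simpa using hp.1 t, (Y p).periodic_coe⟩, by simpa using hp.2⟩
  · have := (bijective_borderedL hx₀.1.circ (cokerC_pos hx₀ hl) (kerC_pos hx₀ hl)).1
      (hL.trans (borderedL_kerC hx₀ hl).symm)
    rwa [(Prod.mk.inj this).1] at hη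

end critical

end

section

variable {hc : ℝ} {x₀ : ℝ → ℝ}

/-- Every reduced function is `⟨v*, v*⟩ c(ξ, h)` near the bifurcation point. -/
lemma IsReducedFunction.eventually_eq (hx₀ : IsZeroMeanSolution cubic hc x₀)
    (hl : ∫ t in (0 : ℝ)..1, deriv cubic (x₀ t) = 0) {Y : ℝ × ℝ → Circ} {c : ℝ × ℝ → ℝ}
    (hev : ∀ᶠ p in 𝓝 ((0 : ℝ), hc),
      IsForced p.2 (c p) (coker cubic x₀) (fun t => Y p (t : UnitAddCircle)) ∧
      ∫ t in (0 : ℝ)..1, ker cubic x₀ t * (Y p (t : UnitAddCircle) - x₀ t)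
        = ip (ker cubic x₀) (ker cubic x₀) * p.1)
    {g : ℝ → ℝ → ℝ} (hg : IsReducedFunction cubic hc x₀ g) :
    ∀ᶠ p in 𝓝 ((0 : ℝ), hc), g p.1 p.2 = c p * ip (coker cubic x₀) (coker cubic x₀) := by
  obtain ⟨W, ε, δ, hε, hδ, hW⟩ := hg
  filter_upwards [hev, Metric.ball_mem_nhds _ hδ] with p hp hpδ
  rw [Metric.mem_ball, Prod.dist_eq, max_lt_iff, Real.dist_eq, Real.dist_eq, sub_zero] at hpδ
  obtain ⟨h1, -, h3⟩ := hW p.1 p.2 hpδ.1 hpδ.2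
  obtain ⟨κ, h4, h5, h6⟩ := h1.exists_isForced hx₀ hl
  have hκ : c p = κ := by
    have hx₀c := hx₀.1.continuous
    have hvc := continuous_ker hx₀c
    have hYc := (Y p).continuous_coe
    have hyc := h4.continuous
    refine (hp.1.unique (coker_pos x₀) hvc (ker_pos x₀) h4 ?_).1
    have h7 := sub_eq_zero.2 (h5.trans hp.2.symm)
    rw [← intervalIntegral.integral_sub] at h7
    · rw [← h7]
      congr 1; ext t; ring
    all_goals exact Continuous.intervalIntegrable (by fun_prop) _ _
  rw [h3, h6, hκ]

/-- The reduced function exists. Uniqueness of `W` holds without any smallness of `W`, since a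
solution of the equation with forcing `κ v*` is determined by its `v`-mean. -/
lemma exists_isReducedFunction (hx₀ : IsZeroMeanSolution cubic hc x₀)
    (hl : ∫ t in (0 : ℝ)..1, deriv cubic (x₀ t) = 0) :
    ∃ g, IsReducedFunction cubic hc x₀ g := by
  obtain ⟨Y, c, hY, hcd, hY0, hc0, hev, -⟩ := exists_reduction_family hx₀ hl
  have hYc := hY.continuousAt
  have hcc := hcd.continuousAt
  -- `R` is the function `W = Y - x₀ - ξ v`, and `R'` is its derivative in time.
  set R : ℝ × ℝ → Circ := fun p => Y p - hx₀.1.circ - p.1 • kerC hx₀ hl with hR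
  set R' : ℝ × ℝ → Circ := fun p => (Y p - Y p ^ 3 + p.2 • cosC + c p • cokerC hx₀ hl)
    - (hx₀.1.circ - hx₀.1.circ ^ 3 + hc • cosC)
    - p.1 • ((1 - (3 : ℝ) • hx₀.1.circ ^ 2) * kerC hx₀ hl) with hR'
  have hRc : ContinuousAt R (0, hc) := by fun_prop
  have hRc' : ContinuousAt R' (0, hc) := by fun_prop
  have hR0 : R (0, hc) = 0 := by simp [hR, hY0]
  have hR0' : R' (0, hc) = 0 := by simp [hR', hY0, hc0]
  have hsmall : ∀ᶠ p in 𝓝 ((0 : ℝ), hc), ‖R p‖ < 1 ∧ ‖R' p‖ < 1 := by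
    have h1 := hRc.norm.eventually_lt_const (u := 1) (by simp [hR0])
    have h2 := hRc'.norm.eventually_lt_const (u := 1) (by simp [hR0'])
    exact h1.and h2
  obtain ⟨δ, hδ, hball⟩ := Metric.eventually_nhds_iff.1 (hev.and hsmall)
  refine ⟨fun ξ h => ip (coker cubic x₀) (Phi cubic h fun s => x₀ s + ξ * ker cubic x₀ s
    + (Y (ξ, h) (s : UnitAddCircle) - x₀ s - ξ * ker cubic x₀ s)),
    fun ξ h t => Y (ξ, h) (t : UnitAddCircle) - x₀ t - ξ * ker cubic x₀ t, 1, δ,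
    one_pos, hδ, fun ξ h hξ hh => ?_⟩
  obtain ⟨⟨h1, h2⟩, h3, h4⟩ := hball (y := (ξ, h))
    (by simpa [Prod.dist_eq, Real.dist_eq] using ⟨hξ, hh⟩)
  have hW : SolvesRangeEq cubic x₀ 1 ξ h
      (fun t => Y (ξ, h) (t : UnitAddCircle) - x₀ t - ξ * ker cubic x₀ t) := by
    refine h1.solvesRangeEq hx₀ hl h2 (fun t => ?_) (fun t => ?_)
    · simpa [hR] using ((R (ξ, h)).norm_coe_le_norm (t : UnitAddCircle)).trans_lt h3
    · simpa [hR', cubic, deriv_cubic] using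
        ((R' (ξ, h)).norm_coe_le_norm (t : UnitAddCircle)).trans_lt h4
  refine ⟨hW, fun w hw => ?_, rfl⟩
  obtain ⟨κ, h5, h6, -⟩ := hw.exists_isForced hx₀ hl
  have hx₀c := hx₀.1.continuous
  have hvc := continuous_ker hx₀c
  have hYc := (Y (ξ, h)).continuous_coe
  have hyc := h5.continuous
  have h7 := sub_eq_zero.2 (h6.trans h2.symm)
  rw [← intervalIntegral.integral_sub] at h7
  · have h8 := (h1.unique (coker_pos x₀) hvc (ker_pos x₀) h5 (by
      rw [← h7]; congr 1; ext t; ring)).2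
    ext t
    have := congrFun h8 t
    linarith
  all_goals exact Continuous.intervalIntegrable (by fun_prop) _ _

/-! ### The third derivative of the reduced function -/

lemma ringInverse_apply {u : Circ} (hu : ∀ x, u x ≠ 0) (x : UnitAddCircle) :
    Ring.inverse u x = (u x)⁻¹ := by
  have h1 := Ring.mul_inverse_cancel u (u.isUnit_iff_forall_ne_zero.2 hu)
  have h2 := congrArg (fun y : Circ => y x) h1
  exact eq_inv_of_mul_eq_one_right h2

/-- The functional `P ↦ ∫ e (P² + Q²) / (P Q (P + Q))` with `Q(t) = P(t + 1/2)`. -/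
noncomputable def ratioL (e P : Circ) : ℝ :=
  meanL (e * (P ^ 2 + halfShift P ^ 2) * Ring.inverse (P * halfShift P * (P + halfShift P)))

lemma ratio_denominator_pos {P : Circ} (hP : ∀ x, 0 < P x) (x : UnitAddCircle) :
    0 < (P * halfShift P * (P + halfShift P)) x :=
  mul_pos (mul_pos (hP _) (hP _)) (add_pos (hP _) (hP _))

lemma ratioL_apply {e P : Circ} (hP : ∀ x, 0 < P x) : ratioL e P =
    ∫ t in (0 : ℝ)..1, e (t : UnitAddCircle) *
      (P (t : UnitAddCircle) ^ 2 + P ((t + 1 / 2 : ℝ) : UnitAddCircle) ^ 2) /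
      (P (t : UnitAddCircle) * P ((t + 1 / 2 : ℝ) : UnitAddCircle) *
        (P (t : UnitAddCircle) + P ((t + 1 / 2 : ℝ) : UnitAddCircle))) := by
  rw [ratioL, meanL_apply]
  congr 1
  ext t
  rw [ContinuousMap.mul_apply, ringInverse_apply fun x => (ratio_denominator_pos hP x).ne']
  rfl

lemma continuousAt_ratioL (e : Circ) {P : Circ} (hP : ∀ x, 0 < P x) :
    ContinuousAt (ratioL e) P := by
  have hu : IsUnit (P * halfShift P * (P + halfShift P)) :=
    (ContinuousMap.isUnit_iff_forall_ne_zero _).2 fun x => (ratio_denominator_pos hP x).ne'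
  have hs := continuous_halfShift
  have h1 : ContinuousAt (fun P : Circ => Ring.inverse (P * halfShift P * (P + halfShift P))) P := by
    have h2 := NormedRing.inverse_continuousAt hu.unit
    rw [hu.unit_spec] at h2
    exact ContinuousAt.comp (f := fun P : Circ => P * halfShift P * (P + halfShift P)) h2
      (by fun_prop)
  have h3 : ContinuousAt (fun P : Circ => e * (P ^ 2 + halfShift P ^ 2)) P := by fun_prop
  exact meanL.continuous.continuousAt.comp (h3.mul h1)

/-- Along the branch `Y(ξ, hc) = x₀ + ξ P` the key identity reads
`c(ξ, hc) / ξ³ = ∫ P Q / ∫ v* (P² + Q²) / (P Q (P + Q))`, and `P → v` as `ξ → 0`. -/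
lemma tendsto_forcing_div_cube (hx₀ : IsZeroMeanSolution cubic hc x₀)
    (hl : ∫ t in (0 : ℝ)..1, deriv cubic (x₀ t) = 0) {Y : ℝ × ℝ → Circ} {c : ℝ × ℝ → ℝ}
    (hY0 : Y (0, hc) = hx₀.1.circ)
    (hev : ∀ᶠ p in 𝓝 ((0 : ℝ), hc),
      IsForced p.2 (c p) (coker cubic x₀) (fun t => Y p (t : UnitAddCircle)) ∧
      ∫ t in (0 : ℝ)..1, ker cubic x₀ t * (Y p (t : UnitAddCircle) - x₀ t)
        = ip (ker cubic x₀) (ker cubic x₀) * p.1)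
    (hYd : HasDerivAt (fun ξ => Y (ξ, hc)) (kerC hx₀ hl) 0) :
    Tendsto (fun ξ => c (ξ, hc) / ξ ^ 3) (𝓝[>] 0)
      (𝓝 (ip (ker cubic x₀) (ker cubic x₀) / ip (coker cubic x₀) (coker cubic x₀))) := by
  have hx₀c := hx₀.1.continuous
  have hvc := continuous_ker hx₀c
  have hcc := continuous_coker hx₀c
  set P : ℝ → Circ := fun ξ => ξ⁻¹ • (Y (ξ, hc) - hx₀.1.circ) with hP
  have hPlim : Tendsto P (𝓝[>] 0) (𝓝 (kerC hx₀ hl)) := by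
    have h1 := (hasDerivAt_iff_tendsto_slope.1 hYd).mono_left
      (nhdsWithin_mono (0 : ℝ) (fun x (hx : x ∈ Ioi 0) => (mem_Ioi.1 hx).ne'))
    refine h1.congr fun ξ => ?_
    simp [slope, hP, hY0]
  have hs := continuous_halfShift
  have hnum : Tendsto (fun ξ => meanL (P ξ * halfShift (P ξ))) (𝓝[>] 0)
      (𝓝 (ip (ker cubic x₀) (ker cubic x₀))) := by
    have h1 : Continuous fun y : Circ => meanL (y * halfShift y) := by fun_prop
    have h2 := (h1.tendsto (kerC hx₀ hl)).comp hPlim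
    have h3 : meanL (kerC hx₀ hl * halfShift (kerC hx₀ hl))
        = ip (ker cubic x₀) (ker cubic x₀) := by
      simp only [meanL_apply, ip, ContinuousMap.mul_apply, halfShift_apply, kerC_apply,
        ker_add_half hx₀ hl]
    rwa [h3] at h2
  have hden : Tendsto (fun ξ => ratioL (cokerC hx₀ hl) (P ξ)) (𝓝[>] 0)
      (𝓝 (ip (coker cubic x₀) (coker cubic x₀))) := by
    have h1 := (continuousAt_ratioL (cokerC hx₀ hl) (kerC_pos hx₀ hl)).tendsto.comp hPlim
    have h2 : ratioL (cokerC hx₀ hl) (kerC hx₀ hl) = ip (coker cubic x₀) (coker cubic x₀) := by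
      rw [ratioL_apply (kerC_pos hx₀ hl), ip]
      congr 1
      ext t
      simp only [cokerC_apply, kerC_apply, ker_add_half hx₀ hl, coker_eq_inv]
      have := (ker_pos x₀ t).ne'
      field_simp
    rwa [h2] at h1
  have hBpos : 0 < ip (coker cubic x₀) (coker cubic x₀) :=
    integral_mul_pos hcc (coker_pos x₀) hcc (coker_pos x₀)
  refine (hnum.div hden hBpos.ne').congr' ?_
  have hline : Tendsto (fun ξ : ℝ => (ξ, hc)) (𝓝[>] 0) (𝓝 (0, hc)) := by
    have : ContinuousAt (fun ξ : ℝ => (ξ, hc)) 0 := by fun_prop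
    exact this.tendsto.mono_left nhdsWithin_le_nhds
  filter_upwards [hline.eventually hev, self_mem_nhdsWithin] with ξ hp hξ
  have hξ0 : 0 < ξ := hξ
  have hA : 0 < ip (ker cubic x₀) (ker cubic x₀) :=
    integral_mul_pos hvc (ker_pos x₀) hvc (ker_pos x₀)
  have hlt := (hx₀.1.isForced (coker cubic x₀)).lt (coker_pos x₀) hvc (ker_pos x₀) hp.1
    (hp.2.symm ▸ mul_pos hA hξ0)
  have hPt : ∀ t : ℝ, Y (ξ, hc) (t : UnitAddCircle) - x₀ t = ξ * P ξ (t : UnitAddCircle) :=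
    fun t => by simp [hP, mul_inv_cancel_left₀ hξ0.ne']
  have hPpos : ∀ x, 0 < P ξ x := by
    intro x
    obtain ⟨t, rfl⟩ := QuotientAddGroup.mk_surjective x
    have := sub_pos.2 (hlt t)
    rw [hPt] at this
    exact (pos_iff_pos_of_mul_pos this).1 hξ0
  have hid := integral_deriv_cubic_eq hcc (coker_add_half hx₀ hl) hx₀ hp.1 hlt
  rw [hl] at hid
  simp only [hPt] at hid
  have h1 : ∫ t in (0 : ℝ)..1, ξ * P ξ (t : UnitAddCircle)
      * (ξ * P ξ ((t + 1 / 2 : ℝ) : UnitAddCircle))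
      = ξ ^ 2 * meanL (P ξ * halfShift (P ξ)) := by
    rw [meanL_apply, ← intervalIntegral.integral_const_mul]
    congr 1
    ext t
    simp only [ContinuousMap.mul_apply, halfShift_apply]
    ring
  have h2 : ∫ t in (0 : ℝ)..1, coker cubic x₀ t * ((ξ * P ξ (t : UnitAddCircle)) ^ 2
      + (ξ * P ξ ((t + 1 / 2 : ℝ) : UnitAddCircle)) ^ 2) / (ξ * P ξ (t : UnitAddCircle)
      * (ξ * P ξ ((t + 1 / 2 : ℝ) : UnitAddCircle)) * (ξ * P ξ (t : UnitAddCircle)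
      + ξ * P ξ ((t + 1 / 2 : ℝ) : UnitAddCircle)))
      = ξ⁻¹ * ratioL (cokerC hx₀ hl) (P ξ) := by
    rw [ratioL_apply hPpos, ← intervalIntegral.integral_const_mul]
    congr 1
    ext t
    have h3 := (hPpos (t : UnitAddCircle)).ne'
    have h4 := (hPpos ((t + 1 / 2 : ℝ) : UnitAddCircle)).ne'
    have h5 := (add_pos (hPpos (t : UnitAddCircle)) (hPpos ((t + 1 / 2 : ℝ) : UnitAddCircle))).ne'
    rw [cokerC_apply]
    generalize P ξ (t : UnitAddCircle) = p at *
    generalize P ξ ((t + 1 / 2 : ℝ) : UnitAddCircle) = q at *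
    field_simp
  rw [h1, h2] at hid
  have hRpos : 0 < ratioL (cokerC hx₀ hl) (P ξ) := by
    rw [ratioL_apply hPpos]
    exact integral_ratio_pos (e := fun t => cokerC hx₀ hl (t : UnitAddCircle))
      (p := fun t : ℝ => P ξ (t : UnitAddCircle)) (cokerC hx₀ hl).continuous_coe
      (fun t => cokerC_pos hx₀ hl t) (P ξ).continuous_coe (fun t => hPpos t)
  change meanL (P ξ * halfShift (P ξ)) / ratioL (cokerC hx₀ hl) (P ξ) = c (ξ, hc) / ξ ^ 3
  generalize ratioL (cokerC hx₀ hl) (P ξ) = ρ at *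
  generalize meanL (P ξ * halfShift (P ξ)) = μ at *
  have hξ' := hξ0.ne'
  field_simp at hid ⊢
  linarith

lemma iteratedDeriv_three_cubic (x : ℝ) : iteratedDeriv 3 cubic x = -6 := by
  have h1 : deriv cubic = fun x => 1 - 3 * x ^ 2 := funext deriv_cubic
  have h2 : deriv (fun x : ℝ => 1 - 3 * x ^ 2) = fun x => -6 * x := by
    ext x
    have : HasDerivAt (fun x : ℝ => 1 - 3 * x ^ 2) (-(3 * (2 * x))) x := by
      simpa using! ((hasDerivAt_pow 2 x).const_mul 3).const_sub 1
    rw [this.deriv]; ring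
  have h3 : deriv (fun x : ℝ => -6 * x) x = -6 := by
    simp
  rw [iteratedDeriv_succ, iteratedDeriv_succ, iteratedDeriv_one, h1, h2, h3]

end

end ForcedODE

theorem mainTheorem5 (hc : ℝ) (x₀ : ℝ → ℝ)
    (hx₀ : ForcedODE.IsZeroMeanSolution ForcedODE.cubic hc x₀)
    (hgain : ForcedODE.IsStabilityGaining ForcedODE.cubic hc) :
    ForcedODE.IsSubcriticalPitchfork ForcedODE.cubic hc x₀ ∧
    (∫ s in (0 : ℝ)..1, deriv ForcedODE.cubic (x₀ s)) = 0 ∧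
    (∃ g : ℝ → ℝ → ℝ, ForcedODE.IsReducedFunction ForcedODE.cubic hc x₀ g) ∧
    ∀ g : ℝ → ℝ → ℝ, ForcedODE.IsReducedFunction ForcedODE.cubic hc x₀ g →
      ContDiffAt ℝ ((⊤ : ℕ∞) : WithTop ℕ∞) (fun p : ℝ × ℝ => g p.1 p.2) (0, hc) ∧
      iteratedDeriv 3 (fun ξ => g ξ hc) 0 =
        -∫ s in (0 : ℝ)..1,
          iteratedDeriv 3 ForcedODE.cubic (x₀ s) * ForcedODE.ker ForcedODE.cubic x₀ s ^ 2 ∧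
      0 < iteratedDeriv 3 (fun ξ => g ξ hc) 0 := by
  have hl := ForcedODE.integral_deriv_cubic_eq_zero hx₀ hgain
  refine ⟨ForcedODE.isSubcriticalPitchfork hx₀ hgain, hl,
    ForcedODE.exists_isReducedFunction hx₀ hl, fun g hg => ?_⟩
  obtain ⟨Y, c, -, hcd, hY0, -, hev, hYd⟩ := ForcedODE.exists_reduction_family hx₀ hl
  have hgc := hg.eventually_eq hx₀ hl hev
  have hgd : ContDiffAt ℝ ((⊤ : ℕ∞) : WithTop ℕ∞) (fun p : ℝ × ℝ => g p.1 p.2) (0, hc) :=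
    (hcd.mul contDiffAt_const).congr_of_eventuallyEq hgc
  have hvc := ForcedODE.continuous_ker hx₀.1.continuous
  have hcc := ForcedODE.continuous_coker hx₀.1.continuous
  have hA : 0 < ForcedODE.ip (ForcedODE.ker ForcedODE.cubic x₀)
      (ForcedODE.ker ForcedODE.cubic x₀) :=
    ForcedODE.integral_mul_pos hvc (ForcedODE.ker_pos x₀) hvc (ForcedODE.ker_pos x₀)
  have hB : 0 < ForcedODE.ip (ForcedODE.coker ForcedODE.cubic x₀)
      (ForcedODE.coker ForcedODE.cubic x₀) :=
    ForcedODE.integral_mul_pos hcc (ForcedODE.coker_pos x₀) hcc (ForcedODE.coker_pos x₀)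
  have hline : ContinuousAt (fun ξ : ℝ => (ξ, hc)) 0 := by fun_prop
  have hg3 : ContDiffAt ℝ 3 (fun ξ => g ξ hc) 0 :=
    ContDiffAt.comp (0 : ℝ) (f := fun ξ : ℝ => (ξ, hc))
      (mod_cast contDiffAt_infty.1 hgd 3)
      (contDiffAt_id.prodMk contDiffAt_const)
  have hderiv : iteratedDeriv 3 (fun ξ => g ξ hc) 0 =
      6 * ForcedODE.ip (ForcedODE.ker ForcedODE.cubic x₀) (ForcedODE.ker ForcedODE.cubic x₀) := by
    refine ForcedODE.iteratedDeriv_three_eq_of_tendsto hg3 ?_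
    have h1 := (ForcedODE.tendsto_forcing_div_cube hx₀ hl hY0 hev hYd).mul_const
      (ForcedODE.ip (ForcedODE.coker ForcedODE.cubic x₀) (ForcedODE.coker ForcedODE.cubic x₀))
    rw [div_mul_cancel₀ _ hB.ne'] at h1
    refine h1.congr' ?_
    filter_upwards [(hline.tendsto.mono_left nhdsWithin_le_nhds).eventually hgc] with ξ hξ
    rw [hξ]
    ring
  refine ⟨hgd, ?_, hderiv ▸ by positivity⟩
  rw [hderiv]
  simp only [ForcedODE.iteratedDeriv_three_cubic, ForcedODE.ip]
  rw [intervalIntegral.integral_const_mul]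
  simp only [pow_two]
  ring
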